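/- Let $k$ be an algebraically closed field of characteristic $p \neq 2$ and let $d \geq 1$. Let $V = k v_1 \oplus k v_2$ be the superspace with $v_1$ even and $v_2$ odd, let the symmetric group $\Sigma_d$ act on $V^{\otimes d}$ on the right by $$(v_{i_1} \otimes \cdots \otimes v_{i_j} \otimes v_{i_{j+1}} \otimes \cdots \otimes v_{i_d})\,(j\;\,j{+}1) = (-1)^{\bar v_{i_j} \bar v_{i_{j+1}}}\, v_{i_1} \otimes \cdots \otimes v_{i_{j+1}} \otimes v_{i_j} \otimes \cdots \otimes v_{i_d},$$ where $\bar v_i$ is the parity of $v_i$, and let $S(1|1,d) = \operatorname{End}_{\Sigma_d}(V^{\otimes d})$ be the Schur superalgebra. For $m \geq 1$ let $\tilde{\mathcal A}_m = k\mathcal Q/\mathcal I$, where $\mathcal Q$ is the quiver with $m+1$ vertices $0, 1, \ldots, m$ and arrows $\alpha_i : i-1 \to i$ and $\beta_i : i \to i-1$ for $1 \leq i \leq m$, and, with paths composed from left to right, $\mathcal I$ is the two-sided ideal generated by the relations $\alpha_i\alpha_{i+1} = 0$, $\beta_{i+1}\beta_i = 0$ and $\beta_i\alpha_i = \alpha_{i+1}\beta_{i+1}$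 for $1 \leq i \leq m-1$, and $\alpha_1\beta_1 = \beta_m\alpha_m = 0$. If $p$ divides $d$, then $S(1|1,d)$ is isomorphic, as a $k$-algebra, to $\tilde{\mathcal A}_d$, and it has finite representation type, that is, up to isomorphism it has only finitely many finite-dimensional indecomposable modules. -/

import Mathlib

open scoped TensorProduct

universe u v w

/-! ### The Schur superalgebra -/

section SchurSuperalgebra

/-- The superspace `V` of dimension `m|n`: its standard basis vectors `v_i` are indexed by
`Fin m ⊕ Fin n`, those from `Fin m` being even and those from `Fin n` odd. -/
abbrev SuperSpace (k : Type u) (m n : ℕ) : Type u := Fin m ⊕ Fin n → k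

/-- The index `i` belongs to an odd basis vector of `V`. -/
def IsOddIndex {m n : ℕ} (i : Fin m ⊕ Fin n) : Prop := i.isRight = true

instance {m n : ℕ} (i : Fin m ⊕ Fin n) : Decidable (IsOddIndex i) :=
  inferInstanceAs (Decidable (i.isRight = true))

/-- The pairs of positions `a < b` that `σ` inverts and that carry two odd vectors
in `v_{i_{σ 1}} ⊗ ⋯ ⊗ v_{i_{σ d}}`. -/
def oddInversions {m n d : ℕ} (i : Fin d → Fin m ⊕ Fin n) (σ : Equiv.Perm (Fin d)) :
    Finset (Fin d × Fin d) :=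
  Finset.univ.filter fun x =>
    x.1 < x.2 ∧ σ x.2 < σ x.1 ∧ IsOddIndex (i (σ x.1)) ∧ IsOddIndex (i (σ x.2))

/-- The sign picked up when `σ` permutes the factors of `v_{i_1} ⊗ ⋯ ⊗ v_{i_d}`. -/
def superSign {m n d : ℕ} (i : Fin d → Fin m ⊕ Fin n) (σ : Equiv.Perm (Fin d)) : ℤˣ :=
  (-1) ^ (oddInversions i σ).card

theorem superSign_one {m n d : ℕ} (i : Fin d → Fin m ⊕ Fin n) : superSign i 1 = 1 := by
  have : oddInversions i 1 = ∅ := by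
    refine Finset.filter_eq_empty_iff.mpr fun x _ h => ?_
    exact lt_asymm h.1 h.2.1
  simp [superSign, this]

theorem superSign_eq_prod {m n d : ℕ} (i : Fin d → Fin m ⊕ Fin n) (σ : Equiv.Perm (Fin d)) :
    superSign i σ = ∏ x ∈ Finset.univ.filter (fun x : Fin d × Fin d => x.1 < x.2),
      if σ x.2 < σ x.1 ∧ IsOddIndex (i (σ x.1)) ∧ IsOddIndex (i (σ x.2)) then -1 else 1 := by
  rw [superSign, oddInversions, Finset.prod_ite, Finset.prod_const, Finset.prod_const_one, mul_one,
    Finset.filter_filter]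

theorem superSign_mul {m n d : ℕ} (i : Fin d → Fin m ⊕ Fin n) (σ τ : Equiv.Perm (Fin d)) :
    superSign i (σ * τ) = superSign i σ * superSign (i ∘ σ) τ := by
  have key : superSign i σ = ∏ x ∈ Finset.univ.filter (fun x : Fin d × Fin d => x.1 < x.2),
      if ((τ x.1 < τ x.2 ∧ σ (τ x.2) < σ (τ x.1)) ∨ (τ x.2 < τ x.1 ∧ σ (τ x.1) < σ (τ x.2))) ∧
        IsOddIndex (i (σ (τ x.1))) ∧ IsOddIndex (i (σ (τ x.2))) then (-1 : ℤˣ) else 1 := by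
    rw [superSign_eq_prod]
    symm
    refine Finset.prod_bij
      (fun x _ => if τ x.1 < τ x.2 then (τ x.1, τ x.2) else (τ x.2, τ x.1)) ?_ ?_ ?_ ?_
    · rintro ⟨a, b⟩ h
      simp only [Finset.mem_filter, Finset.mem_univ, true_and] at h ⊢
      have : τ a ≠ τ b := fun e => h.ne (τ.injective e)
      split_ifs with h1
      · exact h1
      · exact lt_of_le_of_ne (not_lt.mp h1) this.symm
    · rintro ⟨a, b⟩ h ⟨a', b'⟩ h' e
      simp only [Finset.mem_filter, Finset.mem_univ, true_and] at h h'
      dsimp only at e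
      split_ifs at e <;>
        simp only [Prod.mk.injEq, EmbeddingLike.apply_eq_iff_eq] at e ⊢
      · exact e
      · rw [e.1, e.2] at h; exact absurd h (lt_asymm h')
      · rw [e.1, e.2] at h; exact absurd h (lt_asymm h')
      · exact e.symm
    · rintro ⟨a, b⟩ h
      simp only [Finset.mem_filter, Finset.mem_univ, true_and] at h
      rcases lt_trichotomy (τ.symm a) (τ.symm b) with h1 | h1 | h1
      · exact ⟨(τ.symm a, τ.symm b), by simpa using h1, by simp [h]⟩
      · exact absurd (τ.symm.injective h1) h.ne
      · exact ⟨(τ.symm b, τ.symm a), by simpa using h1, by simp [not_lt_of_gt h]⟩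
    · rintro ⟨a, b⟩ h
      simp only [Finset.mem_filter, Finset.mem_univ, true_and] at h
      by_cases h1 : τ a < τ b
      · simp [h1, not_lt_of_gt h1]
      · have h2 : τ b < τ a :=
          lt_of_le_of_ne (not_lt.mp h1) fun e => h.ne (τ.injective e).symm
        simp only [h1, h2, false_and, true_and, false_or, if_false]
        congr 1
        simp only [eq_iff_iff]
        tauto
  rw [key, superSign_eq_prod, superSign_eq_prod, ← Finset.prod_mul_distrib]
  refine Finset.prod_congr rfl ?_
  rintro ⟨a, b⟩ h
  simp only [Finset.mem_filter, Finset.mem_univ, true_and] at h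
  simp only [Equiv.Perm.mul_apply, Function.comp_apply]
  have hτ : τ a ≠ τ b := fun e => h.ne (τ.injective e)
  have hσ : σ (τ a) ≠ σ (τ b) := fun e => hτ (σ.injective e)
  by_cases ho : IsOddIndex (i (σ (τ a))) ∧ IsOddIndex (i (σ (τ b)))
  · rcases lt_or_gt_of_ne hτ with h1 | h1 <;> rcases lt_or_gt_of_ne hσ with h2 | h2 <;>
      simp [ho.1, ho.2, h1, h2, not_lt_of_gt h1, not_lt_of_gt h2]
  · simp [ho]

variable (k : Type u) [Field k] (m n d : ℕ)

/-- The tensor space `V^{⊗ d}`. -/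
def TensorSpace : Type u := ⨂[k]^d (SuperSpace k m n)

noncomputable instance : AddCommGroup (TensorSpace k m n d) :=
  inferInstanceAs (AddCommGroup (⨂[k]^d (SuperSpace k m n)))

noncomputable instance : Module k (TensorSpace k m n d) :=
  inferInstanceAs (Module k (⨂[k]^d (SuperSpace k m n)))

/-- The basis `v_{i_1} ⊗ ⋯ ⊗ v_{i_d}` of `V^{⊗ d}`. -/
noncomputable def tensorBasis :
    Module.Basis (Fin d → Fin m ⊕ Fin n) k (TensorSpace k m n d) :=
  Basis.piTensorProduct fun _ => Pi.basisFun k (Fin m ⊕ Fin n)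

/-- The action of `σ` on `V^{⊗ d}`:
`(v_{i_1} ⊗ ⋯ ⊗ v_{i_d}) σ = ± v_{i_{σ 1}} ⊗ ⋯ ⊗ v_{i_{σ d}}`. -/
noncomputable def tensorAct (σ : Equiv.Perm (Fin d)) : Module.End k (TensorSpace k m n d) :=
  (tensorBasis k m n d).constr k fun i =>
    ((superSign i σ : ℤˣ) : ℤ) • tensorBasis k m n d (i ∘ σ)

theorem tensorAct_basis (σ : Equiv.Perm (Fin d)) (i : Fin d → Fin m ⊕ Fin n) :
    tensorAct k m n d σ (tensorBasis k m n d i) =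
      ((superSign i σ : ℤˣ) : ℤ) • tensorBasis k m n d (i ∘ σ) := by
  simp [tensorAct]

/-- The signed right action of the symmetric group on `V^{⊗ d}`, as a representation of the
opposite group. -/
noncomputable def tensorRep :
    Representation k (Equiv.Perm (Fin d))ᵐᵒᵖ (TensorSpace k m n d) where
  toFun σ := tensorAct k m n d σ.unop
  map_one' := by
    refine (tensorBasis k m n d).ext fun i => ?_
    simp [tensorAct_basis, superSign_one]
  map_mul' σ τ := by
    refine (tensorBasis k m n d).ext fun i => ?_
    rw [MulOpposite.unop_mul, Module.End.mul_apply, tensorAct_basis, tensorAct_basis, map_zsmul,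
      tensorAct_basis, superSign_mul, smul_smul, Units.val_mul]
    rfl

/-- The adjacent transposition `(j j+1)` interchanges the factors in these positions, with the
sign `-1` if both are odd and `1` otherwise. -/
theorem tensorRep_swap (j l : Fin d) (hl : (j : ℕ) + 1 = l) (i : Fin d → Fin m ⊕ Fin n) :
    tensorRep k m n d (MulOpposite.op (Equiv.swap j l)) (tensorBasis k m n d i) =
      (if IsOddIndex (i j) ∧ IsOddIndex (i l) then (-1 : k) else 1) •
        tensorBasis k m n d (i ∘ Equiv.swap j l) := by
  have hjl : j < l := by rw [Fin.lt_def]; omega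
  have h : oddInversions i (Equiv.swap j l) =
      if IsOddIndex (i j) ∧ IsOddIndex (i l) then {(j, l)} else ∅ := by
    ext ⟨a, b⟩
    have h1 : a < b ∧ Equiv.swap j l b < Equiv.swap j l a ↔ a = j ∧ b = l := by
      constructor
      · rintro ⟨hab, h⟩
        rw [Equiv.swap_apply_def, Equiv.swap_apply_def] at h
        split_ifs at h <;> simp only [Fin.lt_def, Fin.ext_iff] at * <;> omega
      · rintro ⟨rfl, rfl⟩
        simpa using hjl
    rw [oddInversions, Finset.mem_filter, ← and_assoc (a := a < b), h1]
    simp only [Finset.mem_univ, true_and]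
    constructor
    · rintro ⟨⟨rfl, rfl⟩, h2, h3⟩
      rw [Equiv.swap_apply_left] at h2
      rw [Equiv.swap_apply_right] at h3
      simp [h2, h3]
    · intro h
      split_ifs at h with h2
      · simp only [Finset.mem_singleton, Prod.mk.injEq] at h
        obtain ⟨rfl, rfl⟩ := h
        simp [h2.1, h2.2]
      · simp at h
  change tensorAct k m n d (Equiv.swap j l) _ = _
  rw [tensorAct_basis, superSign, h]
  split_ifs <;> simp [neg_smul]

/-- The Schur superalgebra `S(m|n,d)`: the algebra of all linear endomorphisms of `V^{⊗ d}` that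
commute with the action of the symmetric group. -/
noncomputable abbrev SchurSuperalgebra : Subalgebra k (Module.End k (TensorSpace k m n d)) :=
  Subalgebra.centralizer k (Set.range (tensorRep k m n d))

end SchurSuperalgebra

/-! ### Path algebras -/

section PathAlgebra

/-- The path algebra `kQ`: the vector space with basis all paths (of length `≥ 0`) of the quiver
`Q`. -/
def PathAlgebra (k : Type u) [Field k] (Q : Type v) [Quiver.{w} Q] : Type (max u v w) :=
  (Σ a b : Q, Quiver.Path a b) →₀ k

namespace PathAlgebra

variable (k : Type u) [Field k] {Q : Type v} [Quiver.{w} Q]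

noncomputable instance : AddCommGroup (PathAlgebra k Q) :=
  inferInstanceAs (AddCommGroup ((Σ a b : Q, Quiver.Path a b) →₀ k))

noncomputable instance : Module k (PathAlgebra k Q) :=
  inferInstanceAs (Module k ((Σ a b : Q, Quiver.Path a b) →₀ k))

/-- The basis of the path algebra that consists of the paths. -/
noncomputable def basis : Module.Basis (Σ a b : Q, Quiver.Path a b) k (PathAlgebra k Q) :=
  Finsupp.basisSingleOne

/-- The path `q` as an element of the path algebra. -/
noncomputable def ofPath {a b : Q} (q : Quiver.Path a b) : PathAlgebra k Q :=
  basis k ⟨a, b, q⟩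

open Classical in
/-- The product of two paths: first `x`, then `y`, if `x` ends where `y` starts, and `0` if not. -/
noncomputable def concat (x y : Σ a b : Q, Quiver.Path a b) : PathAlgebra k Q :=
  if h : x.2.1 = y.1 then ofPath k ((x.2.2.cast rfl h).comp y.2.2) else 0

/-- The multiplication of the path algebra: concatenation of paths, extended bilinearly. -/
noncomputable def mulLin : PathAlgebra k Q →ₗ[k] PathAlgebra k Q →ₗ[k] PathAlgebra k Q :=
  (basis k).constr k fun x => (basis k).constr k fun y => concat k x y

noncomputable instance : Mul (PathAlgebra k Q) := ⟨fun f g => mulLin k f g⟩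

theorem mul_def (f g : PathAlgebra k Q) : f * g = mulLin k f g := rfl

theorem basis_mul_basis (x y : Σ a b : Q, Quiver.Path a b) :
    basis k x * basis k y = concat k x y := by
  simp [mul_def, mulLin]

theorem ofPath_mul_ofPath {a b c : Q} (x : Quiver.Path a b) (y : Quiver.Path b c) :
    ofPath k x * ofPath k y = ofPath k (x.comp y) := by
  simp [ofPath, basis_mul_basis, concat]

theorem ofPath_mul_ofPath_of_ne {a b c e : Q} (x : Quiver.Path a b) (y : Quiver.Path c e)
    (h : b ≠ c) : ofPath k x * ofPath k y = 0 := by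
  simp [ofPath, basis_mul_basis, concat, h]

noncomputable instance : NonUnitalRing (PathAlgebra k Q) where
  left_distrib f g h := by simp [mul_def]
  right_distrib f g h := by simp [mul_def]
  zero_mul f := by simp [mul_def]
  mul_zero f := by simp [mul_def]
  mul_assoc f g h := by
    have hz : ∀ f : PathAlgebra k Q, 0 * f = 0 := fun f => by simp [mul_def]
    have hz' : ∀ f : PathAlgebra k Q, f * 0 = 0 := fun f => by simp [mul_def]
    have key : (mulLin k).compr₂ (mulLin k) =
        ((LinearMap.llcomp k (PathAlgebra k Q) (PathAlgebra k Q) (PathAlgebra k Q)).comp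
          (mulLin k)).compl₁₂ LinearMap.id (mulLin k) := by
      refine (basis k).ext fun x => (basis k).ext fun y => (basis k).ext fun z => ?_
      obtain ⟨a, b, x⟩ := x
      obtain ⟨c, e, y⟩ := y
      obtain ⟨g, h, z⟩ := z
      change (ofPath k x * ofPath k y) * ofPath k z = ofPath k x * (ofPath k y * ofPath k z)
      by_cases h1 : b = c
      · subst h1
        by_cases h2 : e = g
        · subst h2
          simp only [ofPath_mul_ofPath, Quiver.Path.comp_assoc]
        · rw [ofPath_mul_ofPath, ofPath_mul_ofPath_of_ne k _ _ h2, ofPath_mul_ofPath_of_ne k _ _ h2,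
            hz']
      · by_cases h2 : e = g
        · subst h2
          rw [ofPath_mul_ofPath, ofPath_mul_ofPath_of_ne k _ _ h1, ofPath_mul_ofPath_of_ne k _ _ h1,
            hz]
        · rw [ofPath_mul_ofPath_of_ne k _ _ h1, ofPath_mul_ofPath_of_ne k _ _ h2, hz, hz']
    exact LinearMap.congr_fun (LinearMap.congr_fun (LinearMap.congr_fun key f) g) h

/-- The unit of the path algebra of a quiver with finitely many vertices is the sum of the trivial
paths. -/
noncomputable instance [Fintype Q] : One (PathAlgebra k Q) :=
  ⟨∑ a : Q, ofPath k (Quiver.Path.nil : Quiver.Path a a)⟩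

theorem one_def [Fintype Q] :
    (1 : PathAlgebra k Q) = ∑ a : Q, ofPath k (Quiver.Path.nil : Quiver.Path a a) := rfl

noncomputable instance [Fintype Q] : Ring (PathAlgebra k Q) where
  __ := (inferInstance : NonUnitalRing (PathAlgebra k Q))
  one_mul f := by
    have key : mulLin k (1 : PathAlgebra k Q) = LinearMap.id := by
      refine (basis k).ext ?_
      rintro ⟨a, b, x⟩
      change 1 * ofPath k x = ofPath k x
      rw [one_def, Finset.sum_mul, Finset.sum_eq_single a, ofPath_mul_ofPath,
        Quiver.Path.nil_comp]
      · exact fun c _ hc => ofPath_mul_ofPath_of_ne k _ _ hc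
      · simp
    exact LinearMap.congr_fun key f
  mul_one f := by
    have key : (mulLin k).flip (1 : PathAlgebra k Q) = LinearMap.id := by
      refine (basis k).ext ?_
      rintro ⟨a, b, x⟩
      change ofPath k x * 1 = ofPath k x
      rw [one_def, Finset.mul_sum, Finset.sum_eq_single b, ofPath_mul_ofPath,
        Quiver.Path.comp_nil]
      · exact fun c _ hc => ofPath_mul_ofPath_of_ne k _ _ hc.symm
      · simp
    exact LinearMap.congr_fun key f

noncomputable instance [Fintype Q] : Algebra k (PathAlgebra k Q) :=
  Algebra.ofModule (fun r f g => by simp [mul_def]) (fun r f g => by simp [mul_def])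

/-- The arrow `e`, a path of length one, as an element of the path algebra. -/
noncomputable def ofArrow {a b : Q} (e : a ⟶ b) : PathAlgebra k Q := ofPath k e.toPath

end PathAlgebra

end PathAlgebra

/-! ### The algebra `Ã_m` -/

section ATilde

/-- The vertices `0, …, m` of the doubled quiver of type `A_{m+1}`. -/
def DoubledA (m : ℕ) : Type := Fin (m + 1)

instance (m : ℕ) : Fintype (DoubledA m) := inferInstanceAs (Fintype (Fin (m + 1)))

/-- The arrows of the doubled quiver of type `A_{m+1}`. With `i = 0, …, m - 1`, the arrow `α i`
from `i` to `i + 1` is the one usually written `α_{i+1}`, and `β i` from `i + 1` to `i` is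
`β_{i+1}`. -/
inductive DoubledA.Arrow (m : ℕ) : DoubledA m → DoubledA m → Type
  | α (i : Fin m) : DoubledA.Arrow m i.castSucc i.succ
  | β (i : Fin m) : DoubledA.Arrow m i.succ i.castSucc

instance (m : ℕ) : Quiver (DoubledA m) := ⟨DoubledA.Arrow m⟩

variable (k : Type u) [Field k] (m : ℕ)

/-- The arrow `α i : i → i + 1` in the path algebra. -/
noncomputable def alphaElt (i : Fin m) : PathAlgebra k (DoubledA m) :=
  PathAlgebra.ofArrow k (Q := DoubledA m) (DoubledA.Arrow.α i)

/-- The arrow `β i : i + 1 → i` in the path algebra. -/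
noncomputable def betaElt (i : Fin m) : PathAlgebra k (DoubledA m) :=
  PathAlgebra.ofArrow k (Q := DoubledA m) (DoubledA.Arrow.β i)

/-- The relations of `Ã_m` (paths are composed from left to right). -/
inductive ATildeRel : PathAlgebra k (DoubledA m) → PathAlgebra k (DoubledA m) → Prop
  | alpha_alpha (i j : Fin m) (h : (i : ℕ) + 1 = j) : ATildeRel (alphaElt k m i * alphaElt k m j) 0
  | beta_beta (i j : Fin m) (h : (i : ℕ) + 1 = j) : ATildeRel (betaElt k m j * betaElt k m i) 0
  | alpha_beta_first (i : Fin m) (h : (i : ℕ) = 0) : ATildeRel (alphaElt k m i * betaElt k m i) 0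
  | beta_alpha_last (i : Fin m) (h : (i : ℕ) + 1 = m) : ATildeRel (betaElt k m i * alphaElt k m i) 0
  | comm (i j : Fin m) (h : (i : ℕ) + 1 = j) :
      ATildeRel (betaElt k m i * alphaElt k m i) (alphaElt k m j * betaElt k m j)

/-- The algebra `Ã_m = kQ/I`: the quotient of the path algebra by the two-sided ideal that is
generated by the relations. -/
abbrev ATilde : Type u := RingQuot (ATildeRel k m)

end ATilde

/-! ### Finite representation type -/

/-- A module is indecomposable if it is nonzero and not the internal direct sum of two nonzero
submodules. -/
def IsIndecomposableModule (A : Type v) [Ring A] (N : Type w) [AddCommGroup N] [Module A N] :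
    Prop :=
  Nontrivial N ∧ ∀ N₁ N₂ : Submodule A N, IsCompl N₁ N₂ → N₁ = ⊥ ∨ N₂ = ⊥

/-- The `k`-algebra `A` has finite representation type: finitely many modules represent all
isomorphism classes of finite-dimensional indecomposable `A`-modules. (Each finite-dimensional
module is isomorphic to one whose underlying type lies in the universe of `k`.) -/
def HasFiniteRepresentationType (k : Type u) [Field k] (A : Type v) [Ring A] [Algebra k A] : Prop :=
  ∃ (r : ℕ) (M : Fin r → ModuleCat.{u} A),
    ∀ (N : Type u) [AddCommGroup N] [Module k N] [Module A N] [IsScalarTower k A N],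
      FiniteDimensional k N → IsIndecomposableModule A N → ∃ i, Nonempty (N ≃ₗ[A] M i)

/-! Both claims are reduced to one structure, a ladder: a grading by idempotents with a commuting
pair of square-zero elements, `a` lowering and `b` raising the degree.

Tensor space carries fermionic operators: `raiseOp` sums, over all positions, the signed operator
that turns an even factor into an odd one, and `lowerOp` does the reverse. The summands satisfy
canonical anticommutation relations, so both operators square to zero and `raiseOp * lowerOp +
lowerOp * raiseOp = d`. If `p` divides `d`, they anticommute; twisting `raiseOp` by the parity
operator makes them commute, and the projections onto the number of odd factors complete a ladder
(`isLadder_operators`). It generates the Schur superalgebra (`exists_mul_degProj_eq`): an element is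
determined on degree `n` by its value on one basis vector. Equivariance kills every coefficient of
this value except at four types of positions (no change, one factor made even, one made odd, one of
each), and leaves one parameter for each type. The operators `1`, `lowerOp`, `raiseOp` and their
product realize all parameters.

The algebra `Ã_m` is generated by its own ladder of vertices, sum of the `α` and sum of the `β`, and
it maps to every algebra with a ladder (`IsLadder.exists_algHom`). Since `A e_j` is spanned by `e_j,
a e_j, b e_j, ab e_j`, such a map is injective as soon as `ab e_j ≠ 0` for `0 < j < m`
(`IsLadder.injective_of_ne_zero`); this gives the isomorphism.

For finite representation type, let `N` be indecomposable over an algebra generated by a ladder. If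
`ab` acts nontrivially, then some `x, ax, bx, abx` span a direct summand, hence all of `N`
(`HasDiamondBasis.of_smul_ne_zero`). If `ab = 0`, then `N` splits into representations of zigzags of
type `A`, and a string can be split off by following linear relations along a zigzag
(`IsLadder.exists_string`). A diamond is determined by its degree and a string by its two ends and
its orientation, so only finitely many isomorphism classes occur. -/

/-! ### Ladders: commuting square-zero elements of degree `-1` and `1` in a graded algebra -/

/-- Orthogonal idempotents `e 0, …, e m` with sum `1`, together with commuting elements `a`, `b` of
square zero that lower and raise the degree by one. -/
structure IsLadder {A : Type*} [Ring A] (m : ℕ) (e : ℕ → A) (a b : A) : Prop where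
  e_eq_zero : ∀ j, m < j → e j = 0
  e_mul_e : ∀ i j, e i * e j = if i = j then e j else 0
  sum_e : ∑ j ∈ Finset.range (m + 1), e j = 1
  e_mul_a : ∀ j, e j * a = a * e (j + 1)
  e_mul_b : ∀ j, e (j + 1) * b = b * e j
  a_mul_a : a * a = 0
  b_mul_b : b * b = 0
  comm : a * b = b * a

namespace IsLadder

section Ring

variable {A : Type*} [Ring A] {m : ℕ} {e : ℕ → A} {a b : A}

theorem e_mul_self (h : IsLadder m e a b) (j : ℕ) : e j * e j = e j := by simp [h.e_mul_e]

theorem eq_zero_of_forall_e_mul (h : IsLadder m e a b) {x : A} (hx : ∀ j, e j * x = 0) : x = 0 := by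
  rw [← one_mul x, ← h.sum_e, Finset.sum_mul]
  exact Finset.sum_eq_zero fun j _ => hx j

theorem eq_zero_of_forall_mul_e (h : IsLadder m e a b) {x : A} (hx : ∀ j, x * e j = 0) : x = 0 := by
  rw [← mul_one x, ← h.sum_e, Finset.mul_sum]
  exact Finset.sum_eq_zero fun j _ => hx j

/-- There is no degree below `0`: each component `e j * a * e 0 = a * e (j + 1) * e 0` vanishes. -/
theorem a_mul_e_zero (h : IsLadder m e a b) : a * e 0 = 0 := by
  refine h.eq_zero_of_forall_e_mul fun j => ?_
  rw [← mul_assoc, h.e_mul_a, mul_assoc, h.e_mul_e, if_neg (by omega), mul_zero]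

theorem e_zero_mul_b (h : IsLadder m e a b) : e 0 * b = 0 := by
  refine h.eq_zero_of_forall_mul_e fun j => ?_
  rw [mul_assoc, ← h.e_mul_b, ← mul_assoc, h.e_mul_e, if_neg (by omega), zero_mul]

theorem e_mul_ab (h : IsLadder m e a b) (j : ℕ) : e j * (a * b) = a * b * e j := by
  rw [← mul_assoc, h.e_mul_a, mul_assoc, h.e_mul_b, mul_assoc]

theorem map {B : Type*} [Ring B] {F : Type*} [FunLike F A B] [RingHomClass F A B]
    (h : IsLadder m e a b) (f : F) : IsLadder m (fun j => f (e j)) (f a) (f b) where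
  e_eq_zero j hj := by simp [h.e_eq_zero j hj]
  e_mul_e i j := by rw [← map_mul, h.e_mul_e]; split_ifs <;> simp
  sum_e := by rw [← map_sum, h.sum_e, map_one]
  e_mul_a j := by rw [← map_mul, h.e_mul_a, map_mul]
  e_mul_b j := by rw [← map_mul, h.e_mul_b, map_mul]
  a_mul_a := by rw [← map_mul, h.a_mul_a, map_zero]
  b_mul_b := by rw [← map_mul, h.b_mul_b, map_zero]
  comm := by rw [← map_mul, h.comm, map_mul]

end Ring

section Algebra

variable {k : Type*} [Field k] {A : Type*} [Ring A] [Algebra k A] {m : ℕ} {e : ℕ → A} {a b : A}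

/-- In an algebra generated by a ladder, `A e_j` is spanned by `e_j`, `a e_j`, `b e_j`, `ab e_j`. -/
theorem exists_mul_e_eq (h : IsLadder m e a b)
    (hgen : Algebra.adjoin k (Set.range e ∪ {a, b}) = ⊤) (x : A) (j : ℕ) :
    ∃ c₁ c₂ c₃ c₄ : k,
      x * e j = c₁ • e j + c₂ • (a * e j) + c₃ • (b * e j) + c₄ • (a * b * e j) := by
  set L : Submodule k A := Submodule.span k {e j, a * e j, b * e j, a * b * e j} with hL
  have h1 : e j ∈ L := Submodule.subset_span (by simp)
  have h2 : a * e j ∈ L := Submodule.subset_span (by simp)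
  have h3 : b * e j ∈ L := Submodule.subset_span (by simp)
  have h4 : a * b * e j ∈ L := Submodule.subset_span (by simp)
  have gen : ∀ x : A, x * e j ∈ L → x * (a * e j) ∈ L → x * (b * e j) ∈ L →
      x * (a * b * e j) ∈ L → ∀ y ∈ L, x * y ∈ L := by
    intro x x1 x2 x3 x4 y hy
    induction hy using Submodule.span_induction with
    | mem y hy =>
      simp only [Set.mem_insert_iff, Set.mem_singleton_iff] at hy
      rcases hy with rfl | rfl | rfl | rfl <;> assumption
    | zero => simp
    | add y z _ _ hy hz => rw [mul_add]; exact L.add_mem hy hz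
    | smul c y _ hy => rw [mul_smul_comm]; exact L.smul_mem c hy
  -- Stability of `L` under left multiplication passes from the generators to the whole algebra, and
  -- `e j ∈ L`.
  have key : ∀ x ∈ Algebra.adjoin k (Set.range e ∪ {a, b}), ∀ y ∈ L, x * y ∈ L := by
    intro x hx
    induction hx using Algebra.adjoin_induction with
    | mem x hx =>
      rcases hx with ⟨i, rfl⟩ | rfl | rfl
      · apply gen
        · rw [h.e_mul_e]; split_ifs <;> simp [h1]
        · rw [← mul_assoc, h.e_mul_a, mul_assoc, h.e_mul_e]; split_ifs <;> simp [h2]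
        · rcases i with _ | i
          · rw [← mul_assoc, h.e_zero_mul_b]; simp
          · rw [← mul_assoc, h.e_mul_b, mul_assoc, h.e_mul_e]; split_ifs <;> simp [h3]
        · rw [← mul_assoc, h.e_mul_ab, mul_assoc (a * b), h.e_mul_e]; split_ifs <;> simp [h4]
      · apply gen
        · exact h2
        · rw [← mul_assoc, h.a_mul_a]; simp
        · rwa [← mul_assoc]
        · rw [← mul_assoc, ← mul_assoc, h.a_mul_a]; simp
      · apply gen
        · exact h3
        · rwa [← mul_assoc, ← h.comm]
        · rw [← mul_assoc, h.b_mul_b]; simp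
        · rw [h.comm, ← mul_assoc, ← mul_assoc, h.b_mul_b]; simp
    | algebraMap r => intro y hy; rw [← Algebra.smul_def]; exact L.smul_mem r hy
    | add x z _ _ hx hz => intro y hy; rw [add_mul]; exact L.add_mem (hx y hy) (hz y hy)
    | mul x z _ _ hx hz => intro y hy; rw [mul_assoc]; exact hx _ (hz y hy)
  have := key x (hgen ▸ Algebra.mem_top) _ h1
  rw [hL, Submodule.mem_span_insert] at this
  obtain ⟨c₁, z, hz, e1⟩ := this
  rw [Submodule.mem_span_insert] at hz
  obtain ⟨c₂, z', hz, rfl⟩ := hz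
  rw [Submodule.mem_span_pair] at hz
  obtain ⟨c₃, c₄, rfl⟩ := hz
  exact ⟨c₁, c₂, c₃, c₄, by rw [e1]; abel⟩

/-- A homomorphism between ladders is injective if the first is generated by its ladder and
`ab e_j ≠ 0` in the second for all interior `j`. -/
theorem injective_of_ne_zero {B : Type*} [Ring B] [Algebra k B] (hm : 2 ≤ m)
    (h : IsLadder m e a b) (hgen : Algebra.adjoin k (Set.range e ∪ {a, b}) = ⊤) (f : A →ₐ[k] B)
    (hne : ∀ j, 0 < j → j < m → f a * f b * f (e j) ≠ 0) : Function.Injective f := by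
  have h' : IsLadder m (fun j => f (e j)) (f a) (f b) := h.map f
  -- All other required non-vanishing follows from the interior products. For the two end degrees
  -- one passes to the neighbouring degree, which is interior because `2 ≤ m`; for `m = 1` the
  -- hypothesis `hne` would be empty.
  have e_ne : ∀ j, j ≤ m → f (e j) ≠ 0 ∧ (j < m → f b * f (e j) ≠ 0) ∧
      (0 < j → f a * f (e j) ≠ 0) := by
    have hb : ∀ j, j < m → f b * f (e j) ≠ 0 := by
      intro j hj h0
      rcases Nat.eq_zero_or_pos j with rfl | h1
      · refine hne 1 one_pos (by omega) ?_
        rw [h'.comm, mul_assoc, ← h'.e_mul_a 0, ← mul_assoc, h0, zero_mul]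
      · exact hne j h1 hj (by rw [mul_assoc, h0, mul_zero])
    have ha : ∀ j, 0 < j → j ≤ m → f a * f (e j) ≠ 0 := by
      intro j h1 hj h0
      rcases hj.eq_or_lt with rfl | h2
      · obtain ⟨j, rfl⟩ : ∃ i, j = i + 1 := ⟨j - 1, by omega⟩
        refine hne j (by omega) (by omega) ?_
        rw [mul_assoc, ← h'.e_mul_b j, ← mul_assoc, h0, zero_mul]
      · exact hne j h1 h2 (by rw [h'.comm, mul_assoc, h0, mul_zero])
    intro j hj
    refine ⟨fun h0 => ?_, hb j, fun h0 => ha j h0 hj⟩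
    rcases hj.eq_or_lt with rfl | h2
    · exact ha j (by omega) le_rfl (by rw [h0, mul_zero])
    · exact hb j h2 (by rw [h0, mul_zero])
  rw [injective_iff_map_eq_zero]
  intro x hx
  refine h.eq_zero_of_forall_mul_e fun j => ?_
  rcases lt_or_ge m j with hj | hj
  · rw [h.e_eq_zero j hj, mul_zero]
  obtain ⟨c₁, c₂, c₃, c₄, hc⟩ := h.exists_mul_e_eq hgen x j
  have hf : c₁ • f (e j) + c₂ • (f a * f (e j)) + c₃ • (f b * f (e j)) +
      c₄ • (f a * f b * f (e j)) = 0 := by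
    have := congrArg f hc
    rw [map_mul, hx, zero_mul] at this
    simpa using this.symm
  rw [hc]
  -- At the two ends `ab e_j` vanishes in both algebras, so only two of the four terms remain, and
  -- `e j` separates them by degree.
  by_cases h0 : j = 0
  · subst h0
    have z1 := h.a_mul_e_zero
    have z1' := h'.a_mul_e_zero
    rw [h'.comm, mul_assoc, z1'] at hf
    simp only [smul_zero, mul_zero, add_zero] at hf
    have := congrArg (f (e 0) * ·) hf
    simp only [mul_add, mul_smul_comm, ← mul_assoc, h'.e_mul_self, h'.e_zero_mul_b, zero_mul,
      smul_zero, add_zero, mul_zero, smul_eq_zero, (e_ne 0 hj).1, or_false] at this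
    subst this
    simp only [zero_smul, zero_add, smul_eq_zero, (e_ne 0 hj).2.1 (by omega), or_false] at hf
    rw [h.comm, mul_assoc, z1, hf]
    simp
  by_cases h1 : j = m
  · have z1 : b * e j = 0 := by rw [← h.e_mul_b, h.e_eq_zero _ (by omega), zero_mul]
    have z1' : f b * f (e j) = 0 := by rw [← map_mul, z1, map_zero]
    rw [mul_assoc, z1'] at hf
    simp only [smul_zero, mul_zero, add_zero] at hf
    have := congrArg (f (e j) * ·) hf
    simp only [mul_add, mul_smul_comm, ← mul_assoc, h'.e_mul_self, h'.e_mul_a] at this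
    rw [mul_assoc, h'.e_mul_e, if_neg (by omega)] at this
    simp only [smul_zero, add_zero, mul_zero, smul_eq_zero, (e_ne j hj).1, or_false] at this
    subst this
    simp only [zero_smul, zero_add, smul_eq_zero, (e_ne j hj).2.2 (by omega), or_false] at hf
    rw [mul_assoc, z1, hf]
    simp
  have hn := hne j (by omega) (by omega)
  have aa : ∀ y, f a * (f a * y) = 0 := fun y => by rw [← mul_assoc, h'.a_mul_a, zero_mul]
  have bb : ∀ y, f b * (f b * y) = 0 := fun y => by rw [← mul_assoc, h'.b_mul_b, zero_mul]
  have ba : ∀ y, f b * (f a * y) = f a * (f b * y) := fun y => by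
    rw [← mul_assoc, ← h'.comm, mul_assoc]
  simp only [mul_assoc] at hf hn
  -- In interior degrees, multiplication by `ab`, then `b`, then `a` moves the first surviving term
  -- to the nonzero socle element `ab e_j`, so the coefficients vanish one after the other.
  have k1 := congrArg (fun y => f a * (f b * y)) hf
  simp only [mul_add, mul_smul_comm, aa, bb, ba, mul_zero, smul_zero, add_zero, smul_eq_zero, hn,
    or_false] at k1
  subst k1
  have k2 := congrArg (fun y => f b * y) hf
  simp only [mul_add, mul_smul_comm, bb, ba, mul_zero, smul_zero, add_zero, smul_eq_zero, hn,
    zero_smul, zero_add, or_false] at k2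
  subst k2
  have k3 := congrArg (fun y => f a * y) hf
  simp only [mul_add, mul_smul_comm, aa, mul_zero, smul_zero, add_zero, smul_eq_zero, hn,
    zero_smul, zero_add, or_false] at k3
  subst k3
  simp only [zero_smul, zero_add, smul_eq_zero, hn, or_false] at hf
  simp [hf]

end Algebra

end IsLadder

/-! ### Chains of linear relations -/

section LinearRelation

variable {k V : Type*} [Field k] [AddCommGroup V] [Module k V]

/-- If the functionals `φ` and `χ` agree along the composition of the linear relations `R` and `C`,
then some functional `ψ` agrees with `φ` along `R` and with `χ` along `C`. -/
theorem exists_dual_between (R C : Submodule k (V × V)) (φ χ : Module.Dual k V)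
    (h : ∀ x y z, (x, y) ∈ R → (y, z) ∈ C → φ x = χ z) :
    ∃ ψ : Module.Dual k V, (∀ x y, (x, y) ∈ R → φ x = ψ y) ∧ ∀ y z, (y, z) ∈ C → ψ y = χ z := by
  -- The values that `ψ` must take are prescribed on the range of `g` by `θ`; the compatibility of
  -- `φ` and `χ` says that this prescription is well defined.
  let g : (R × C) →ₗ[k] V :=
    ((LinearMap.snd k V V).comp R.subtype).coprod ((LinearMap.fst k V V).comp C.subtype)
  let θ : (R × C) →ₗ[k] k :=
    (φ.comp ((LinearMap.fst k V V).comp R.subtype)).coprod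
      (χ.comp ((LinearMap.snd k V V).comp C.subtype))
  have hker : LinearMap.ker g ≤ LinearMap.ker θ := by
    rintro ⟨⟨⟨x, y⟩, hx⟩, ⟨⟨y', z⟩, hz⟩⟩ hg
    have hg' : y + y' = 0 := by simpa [g] using hg
    have hy : y = -y' := eq_neg_of_add_eq_zero_left hg'
    have hz' : (y, -z) ∈ C := by rw [hy]; exact C.neg_mem hz
    have := h x y (-z) hx hz'
    simp [θ, this]
  obtain ⟨ψ, hψ⟩ : ∃ ψ : Module.Dual k V, ψ.comp g = θ := by
    obtain ⟨s, hs⟩ := g.rangeRestrict.exists_rightInverse_of_surjective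
      (LinearMap.range_rangeRestrict g)
    obtain ⟨ψ, hψ⟩ := (θ.comp s).exists_extend
    refine ⟨ψ, LinearMap.ext fun v => ?_⟩
    have h1 : ψ (g v) = θ (s (g.rangeRestrict v)) := LinearMap.congr_fun hψ (g.rangeRestrict v)
    have h2 : g (s (g.rangeRestrict v)) = g v :=
      congrArg Subtype.val (LinearMap.congr_fun hs (g.rangeRestrict v))
    have h3 : s (g.rangeRestrict v) - v ∈ LinearMap.ker g := by simp [h2]
    have h4 := hker h3
    rw [LinearMap.mem_ker, map_sub, sub_eq_zero] at h4
    rw [LinearMap.comp_apply, h1, h4]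
  refine ⟨ψ, fun x y hxy => ?_, fun y z hyz => ?_⟩
  · simpa [g, θ] using (LinearMap.congr_fun hψ (⟨(x, y), hxy⟩, 0)).symm
  · simpa [g, θ] using LinearMap.congr_fun hψ (0, ⟨(y, z), hyz⟩)

/-- The composition of linear relations. -/
def relComp (R C : Submodule k (V × V)) : Submodule k (V × V) where
  carrier := {p | ∃ y, (p.1, y) ∈ R ∧ (y, p.2) ∈ C}
  add_mem' := by
    rintro p q ⟨y, h1, h2⟩ ⟨z, h3, h4⟩
    exact ⟨y + z, R.add_mem h1 h3, C.add_mem h2 h4⟩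
  zero_mem' := ⟨0, R.zero_mem, C.zero_mem⟩
  smul_mem' := by
    rintro c p ⟨y, h1, h2⟩
    exact ⟨c • y, R.smul_mem c h1, C.smul_mem c h2⟩

/-- The linear relation of being joined by a chain of `l` steps that starts in `E`. -/
def chainRel (E : Submodule k V) (C : ℕ → Submodule k (V × V)) : ℕ → Submodule k (V × V)
  | 0 => E.map (LinearMap.prod LinearMap.id LinearMap.id)
  | l + 1 => relComp (chainRel E C l) (C l)

theorem mem_chainRel_zero {E : Submodule k V} {C : ℕ → Submodule k (V × V)} {x y : V} :
    (x, y) ∈ chainRel E C 0 ↔ x ∈ E ∧ y = x := by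
  constructor
  · rintro ⟨z, hz, h⟩
    obtain ⟨rfl, rfl⟩ := Prod.mk.inj h
    exact ⟨hz, rfl⟩
  · rintro ⟨h, rfl⟩
    exact ⟨_, h, rfl⟩

theorem mem_of_mem_chainRel {E : Submodule k V} {C : ℕ → Submodule k (V × V)} {l : ℕ} {x y : V}
    (h : (x, y) ∈ chainRel E C l) : x ∈ E := by
  induction l generalizing y with
  | zero => exact (mem_chainRel_zero.mp h).1
  | succ l ih => obtain ⟨z, hz, -⟩ := h; exact ih hz

/-- `chainRel` records only the two ends of a chain; this recovers the vectors in between. -/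
theorem exists_chain_of_mem_chainRel {E : Submodule k V} {C : ℕ → Submodule k (V × V)} {l : ℕ}
    {x y : V} (h : (x, y) ∈ chainRel E C l) :
    ∃ v : ℕ → V, v 0 = x ∧ v l = y ∧ ∀ j < l, (v j, v (j + 1)) ∈ C j := by
  induction l generalizing y with
  | zero => exact ⟨fun _ => x, rfl, (mem_chainRel_zero.mp h).2.symm, by simp⟩
  | succ l ih =>
    obtain ⟨z, hz, hzy⟩ := h
    obtain ⟨v, h0, hl, hv⟩ := ih hz
    refine ⟨Function.update v (l + 1) y, ?_, by simp, fun j hj => ?_⟩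
    · rw [Function.update_of_ne (by omega), h0]
    · rcases Nat.lt_succ_iff_lt_or_eq.mp hj with hj' | rfl
      · rw [Function.update_of_ne (by omega), Function.update_of_ne (by omega)]; exact hv j hj'
      · rw [Function.update_of_ne (by omega), Function.update_self, hl]; exact hzy

/-- `exists_dual_between` inserts a functional before the last relation, and the rest of the chain
is handled by induction. -/
theorem exists_dual_chain {E : Submodule k V} {C : ℕ → Submodule k (V × V)} {l : ℕ}
    {φ ψ : Module.Dual k V} (h : ∀ x y, (x, y) ∈ chainRel E C l → φ x = ψ y) :
    ∃ f : ℕ → Module.Dual k V, (∀ x ∈ E, φ x = f 0 x) ∧ f l = ψ ∧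
      ∀ j < l, ∀ y z, (y, z) ∈ C j → f j y = f (j + 1) z := by
  induction l generalizing ψ with
  | zero => exact ⟨fun _ => ψ, fun x hx => h x x (mem_chainRel_zero.mpr ⟨hx, rfl⟩), rfl, by simp⟩
  | succ l ih =>
    obtain ⟨θ, h1, h2⟩ := exists_dual_between (chainRel E C l) (C l) φ ψ
      fun x y z hxy hyz => h x z ⟨y, hxy, hyz⟩
    obtain ⟨f, h0, hl, hf⟩ := ih h1
    refine ⟨Function.update f (l + 1) ψ, ?_, by simp, fun j hj y z hyz => ?_⟩
    · rw [Function.update_of_ne (by omega)]; exact h0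
    · rcases Nat.lt_succ_iff_lt_or_eq.mp hj with hj' | rfl
      · rw [Function.update_of_ne (by omega), Function.update_of_ne (by omega)]
        exact hf j hj' y z hyz
      · rw [Function.update_of_ne (by omega), Function.update_self, hl]; exact h2 y z hyz

/-- A sequence of linear relations that dies out contains a chain of vectors that a dual chain of
functionals splits off. -/
theorem exists_chain_and_dual_chain {E : Submodule k V} {C : ℕ → Submodule k (V × V)} (hE : E ≠ ⊥)
    {L : ℕ} (hL : ∀ x y, (x, y) ∈ chainRel E C L → y = 0) :
    ∃ l < L, ∃ (v : ℕ → V) (f : ℕ → Module.Dual k V), v 0 ∈ E ∧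
      (∀ j < l, (v j, v (j + 1)) ∈ C j) ∧ (∀ j < l, ∀ y z, (y, z) ∈ C j → f j y = f (j + 1) z) ∧
      (∀ j ≤ l, f j (v j) = 1) ∧ ((v l, 0) ∈ C l ∨ ∀ y z, (y, z) ∈ C l → f l y = 0) := by
  classical
  -- `P l` says that the relation after `l` steps is no longer both injective and defined on all of
  -- `E`. It holds for `L` and fails for `0`; the chain stops just before its first occurrence.
  let P : ℕ → Prop := fun l => (∃ x, x ≠ 0 ∧ (x, 0) ∈ chainRel E C l) ∨
    ∃ x ∈ E, ∀ y, (x, y) ∉ chainRel E C l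
  have hP0 : ¬ P 0 := by
    rintro (⟨x, hx, h⟩ | ⟨x, hx, h⟩)
    · exact hx (mem_chainRel_zero.mp h).2.symm
    · exact h x (mem_chainRel_zero.mpr ⟨hx, rfl⟩)
  have hPL : P L := by
    by_contra hP
    simp only [P, not_or, not_exists, not_and, not_forall, not_not] at hP
    obtain ⟨x, hx, hx0⟩ := Submodule.exists_mem_ne_zero_of_ne_bot hE
    obtain ⟨y, hy⟩ := hP.2 x hx
    exact hP.1 x hx0 (hL x y hy ▸ hy)
  have hex : ∃ l, P l := ⟨L, hPL⟩
  obtain ⟨l, hl⟩ : ∃ l, Nat.find hex = l + 1 :=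
    Nat.exists_eq_succ_of_ne_zero fun h0 => hP0 (h0 ▸ Nat.find_spec hex)
  have hlP : ¬ P l := Nat.find_min hex (by omega)
  have hP1 : P (l + 1) := hl ▸ Nat.find_spec hex
  have hlL : l < L := by have := Nat.find_min' hex hPL; omega
  simp only [P, not_or, not_exists, not_and, not_forall, not_not] at hlP
  obtain ⟨hZ, hU⟩ := hlP
  suffices h : ∃ x y, (x, y) ∈ chainRel E C l ∧ ∃ φ ψ : Module.Dual k V, φ x = 1 ∧
      (∀ x y, (x, y) ∈ chainRel E C l → φ x = ψ y) ∧
      ((y, 0) ∈ C l ∨ ∀ y z, (y, z) ∈ C l → ψ y = 0) by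
    obtain ⟨x, y, hxy, φ, ψ, hφx, hφ, hend⟩ := h
    obtain ⟨v, hv0, hvl, hv⟩ := exists_chain_of_mem_chainRel hxy
    obtain ⟨f, hf0, hfl, hf⟩ := exists_dual_chain hφ
    refine ⟨l, hlL, v, f, hv0 ▸ mem_of_mem_chainRel hxy, hv, hf, fun j hj => ?_, ?_⟩
    · induction j with
      | zero => rw [hv0, ← hf0 x (mem_of_mem_chainRel hxy), hφx]
      | succ j ih => rw [← hf j (by omega) _ _ (hv j (by omega)), ih (by omega)]
    · rwa [hvl, hfl]
  rcases hP1 with ⟨x, hx0, y, hxy, hy0⟩ | ⟨x, hxE, hx⟩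
  -- Injectivity breaks: some `x ≠ 0` reaches `0`. Any `φ` with `φ x = 1` can be transported to the
  -- end of the chain, because up to step `l` only `0` is related to `0`.
  · obtain ⟨φ, hφ⟩ := Module.Projective.exists_dual_eq_one k hx0
    obtain ⟨ψ, hψ, -⟩ := exists_dual_between (chainRel E C l) ⊥ φ 0 (by
      intro u y z hu hyz
      simp only [Submodule.mem_bot, Prod.mk_eq_zero] at hyz
      by_contra hne
      exact hZ u (fun h0 => hne (by simp [h0])) (hyz.1 ▸ hu))
    exact ⟨x, y, hxy, φ, ψ, hφ, hψ, Or.inl hy0⟩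
  -- The domain shrinks: `x` has no continuation. Here `φ` is chosen to vanish on the new domain, so
  -- the transported `ψ` can be made to vanish on the domain of `C l`.
  · have hxU : x ∉ (chainRel E C (l + 1)).map (LinearMap.fst k V V) := by
      rintro ⟨⟨x', z⟩, hz, rfl⟩
      exact hx z hz
    obtain ⟨φ₀, hφ₀, hker⟩ := Submodule.exists_le_ker_of_notMem hxU
    obtain ⟨y, hy⟩ := hU x hxE
    obtain ⟨ψ, hψ, hψ'⟩ := exists_dual_between (chainRel E C l) (C l) ((φ₀ x)⁻¹ • φ₀) 0 (by
      intro u y z hu hyz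
      have : φ₀ u = 0 := hker ⟨(u, z), ⟨y, hu, hyz⟩, rfl⟩
      simp [this])
    exact ⟨x, y, hy, _, ψ, by simp [hφ₀], hψ, Or.inr fun y z hyz => by simpa using hψ' y z hyz⟩

end LinearRelation

/-! ### String summands of modules on which `ab` vanishes -/

namespace IsLadder

section Strings

variable {k V : Type*} [Field k] [AddCommGroup V] [Module k V] {m : ℕ}
  {e : ℕ → Module.End k V} {a b : Module.End k V}

/-- If `ab = 0`, there is a homogeneous projection onto `ker a ∩ ker b`. -/
theorem exists_projection (h : IsLadder m e a b) (hab : a * b = 0) :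
    ∃ κ : Module.End k V, (∀ j, e j * κ = κ * e j) ∧ κ * κ = κ ∧ a * κ = 0 ∧ b * κ = 0 ∧
      κ * a = a ∧ κ * b = b := by
  let K : Submodule k V := LinearMap.ker a ⊓ LinearMap.ker b
  obtain ⟨π, hπ⟩ := K.subtype.exists_leftInverse_of_injective K.ker_subtype
  let P : Module.End k V := K.subtype.comp π
  have haP : a * P = 0 := LinearMap.ext fun v => (π v).2.1
  have hbP : b * P = 0 := LinearMap.ext fun v => (π v).2.2
  have hP : ∀ y : Module.End k V, a * y = 0 → b * y = 0 → P * y = y := by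
    intro y ha hb
    refine LinearMap.ext fun v => ?_
    have hv : y v ∈ K := ⟨LinearMap.congr_fun ha v, LinearMap.congr_fun hb v⟩
    exact congrArg Subtype.val (LinearMap.congr_fun hπ ⟨y v, hv⟩)
  have hae : ∀ (j : ℕ) (y : Module.End k V), a * y = 0 → a * (e j * y) = 0 := by
    intro j y hy
    rcases j with _ | j
    · rw [← mul_assoc, h.a_mul_e_zero, zero_mul]
    · rw [← mul_assoc, ← h.e_mul_a, mul_assoc, hy, mul_zero]
  have hbe : ∀ (j : ℕ) (y : Module.End k V), b * y = 0 → b * (e j * y) = 0 := by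
    intro j y hy
    rw [← mul_assoc, ← h.e_mul_b, mul_assoc, hy, mul_zero]
  -- Keeping only the degree-preserving part of `P` makes the projection homogeneous. It still fixes
  -- `K`, since `K` is a graded subspace.
  let κ : Module.End k V := ∑ j ∈ Finset.range (m + 1), e j * (P * e j)
  have hκ : ∀ y : Module.End k V, a * y = 0 → b * y = 0 → κ * y = y := by
    intro y ha hb
    simp only [κ, Finset.sum_mul, mul_assoc]
    conv_rhs => rw [← one_mul y, ← h.sum_e, Finset.sum_mul]
    refine Finset.sum_congr rfl fun j _ => ?_
    rw [hP _ (hae j y ha) (hbe j y hb), ← mul_assoc, h.e_mul_self]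
  have haκ : a * κ = 0 := by
    simp only [κ, Finset.mul_sum]
    exact Finset.sum_eq_zero fun j _ => hae j _ (by rw [← mul_assoc, haP, zero_mul])
  have hbκ : b * κ = 0 := by
    simp only [κ, Finset.mul_sum]
    exact Finset.sum_eq_zero fun j _ => hbe j _ (by rw [← mul_assoc, hbP, zero_mul])
  refine ⟨κ, fun i => ?_, hκ κ haκ hbκ, haκ, hbκ, hκ a h.a_mul_a (by rw [← h.comm, hab]),
    hκ b hab h.b_mul_b⟩
  simp only [κ, Finset.mul_sum, Finset.sum_mul]
  refine Finset.sum_congr rfl fun j _ => ?_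
  rw [← mul_assoc, h.e_mul_e, mul_assoc, mul_assoc, h.e_mul_e]
  split_ifs with h1 h2 h2
  · rw [h1]
  · exact absurd h1.symm h2
  · exact absurd h2.symm h1
  · simp

/-- If `ab = 0`, then a nonzero module over a ladder has a string as a direct summand: vectors
`x i, …, x l`, with the dual functionals `c i, …, c l`, on which `a` and `b` act along a zigzag. -/
theorem exists_string (h : IsLadder m e a b) (hab : a * b = 0) [Nontrivial V] :
    ∃ (i l s : ℕ) (x : ℕ → V) (c : ℕ → Module.Dual k V), i ≤ l ∧ l ≤ m ∧ s ≤ 1 ∧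
      (∀ j, j ∉ Set.Icc i l → x j = 0 ∧ c j = 0) ∧
      (∀ j ∈ Set.Icc i l, c j (x j) = 1) ∧
      (∀ j' j, e j' (x j) = if j' = j then x j else 0) ∧
      (∀ j' j v, c j (e j' v) = if j' = j then c j v else 0) ∧
      (∀ j ∈ Set.Icc i l, b (x j) = if Even (j + s) then x (j + 1) else 0) ∧
      (∀ j, j + 1 ∈ Set.Icc i l → a (x (j + 1)) = if Even (j + 1 + s) then x j else 0) ∧
      (∀ j v, j + 1 ∈ Set.Icc i l → c (j + 1) (b v) = if Even (j + 1 + s) then 0 else c j v) ∧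
      (∀ j ∈ Set.Icc i l, ∀ v, c j (a v) = if Even (j + s) then 0 else c (j + 1) v) := by
  classical
  obtain ⟨κ, hκe, hκκ, haκ, hbκ, hκa, hκb⟩ := h.exists_projection hab
  -- Both `a` and `b` vanish on the image of `κ` and map into it. Hence the space is the direct sum
  -- of two zigzags, `s = 0` and `s = 1`: each takes the complement of `κ` in the degrees with `j +
  -- s` even, where the arrows start, and the image of `κ` in the other degrees, where they end.
  let W : ℕ → ℕ → Module.End k V := fun s j => if Even (j + s) then e j * (1 - κ) else e j * κ
  have hex : ∃ s, s ≤ 1 ∧ ∃ j, W s j ≠ 0 := by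
    by_contra hno
    push Not at hno
    have h1 : (1 : Module.End k V) = 0 := by
      rw [← mul_one (1 : Module.End k V)]
      refine h.eq_zero_of_forall_e_mul fun j => ?_
      have h0 := hno 0 (by omega) j
      have h1 := hno 1 (by omega) j
      simp only [W] at h0 h1
      rcases Nat.even_or_odd j with hj | hj
      · rw [if_pos (by simpa using hj)] at h0
        rw [if_neg (by simpa [Nat.even_add_one] using hj)] at h1
        rw [mul_sub, h1] at h0
        simpa using h0
      · rw [if_neg (by simpa using hj)] at h0
        rw [if_pos (by simpa [Nat.even_add_one] using hj)] at h1
        rw [mul_sub, h0] at h1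
        simpa using h1
    exact one_ne_zero h1
  obtain ⟨s, hs, hexj⟩ := hex
  let w : ℕ → Module.End k V := W s
  -- The string starts at the leftmost nonzero degree of the zigzag, so nothing can leave or enter
  -- it on the left.
  let i := Nat.find hexj
  have hi : w i ≠ 0 := Nat.find_spec hexj
  have hmin : ∀ j < i, w j = 0 := fun j hj => not_not.mp (Nat.find_min hexj hj)
  have w_even : ∀ {j}, Even (j + s) → w j = e j * (1 - κ) := fun {j} hj => if_pos hj
  have w_odd : ∀ {j}, ¬ Even (j + s) → w j = e j * κ := fun {j} hj => if_neg hj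
  have hpar : ∀ j, Even (j + 1 + s) ↔ ¬ Even (j + s) := by
    intro j; rw [add_right_comm]; exact Nat.even_add_one
  have e_w : ∀ j' j, e j' * w j = if j' = j then w j else 0 := by
    intro j' j
    by_cases hj : Even (j + s)
    · rw [w_even hj, ← mul_assoc, h.e_mul_e]; split_ifs <;> simp
    · rw [w_odd hj, ← mul_assoc, h.e_mul_e]; split_ifs <;> simp
  have w_comm : ∀ j' j, w j * e j' = e j' * w j := by
    intro j' j
    have hee : e j * e j' = e j' * e j := by
      rw [h.e_mul_e, h.e_mul_e]
      split_ifs with h1 h2 h2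
      · rw [h1]
      · exact absurd h1.symm h2
      · exact absurd h2.symm h1
      · rfl
    by_cases hj : Even (j + s)
    · rw [w_even hj, mul_assoc, sub_mul, ← hκe, one_mul, mul_sub, ← mul_assoc, ← mul_assoc, hee,
        mul_sub, mul_one]
    · rw [w_odd hj, mul_assoc, ← hκe, ← mul_assoc, hee, mul_assoc]
  have w_w : ∀ j, w j * w j = w j := by
    intro j
    by_cases hj : Even (j + s)
    · rw [w_even hj]
      have : (1 - κ) * (e j * (1 - κ)) = e j * (1 - κ) := by
        have hk : κ * (e j * κ) = e j * κ := by rw [← mul_assoc, ← hκe, mul_assoc, hκκ]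
        rw [mul_sub (e j), mul_one, mul_sub, sub_mul, sub_mul, one_mul, one_mul, hk, ← hκe]
        abel
      rw [mul_assoc, this, ← mul_assoc, h.e_mul_self]
    · rw [w_odd hj, mul_assoc, ← mul_assoc κ, ← hκe, mul_assoc (e j) κ κ, hκκ, ← mul_assoc,
        h.e_mul_self]
  have w_zero : ∀ j, m < j → w j = 0 := by
    intro j hj
    by_cases hp : Even (j + s)
    · rw [w_even hp, h.e_eq_zero j hj, zero_mul]
    · rw [w_odd hp, h.e_eq_zero j hj, zero_mul]
  have w_b : ∀ j, w (j + 1) * b = b * w j ∧ (¬ Even (j + s) → b * w j = 0) := by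
    intro j
    by_cases hj : Even (j + s)
    · refine ⟨?_, fun h' => absurd hj h'⟩
      rw [w_even hj, w_odd (by rwa [hpar, not_not]), mul_assoc, hκb, h.e_mul_b, mul_sub, hκe,
        mul_sub, ← mul_assoc b κ, hbκ]
      simp
    · have h1 : b * w j = 0 := by rw [w_odd hj, hκe, ← mul_assoc, hbκ, zero_mul]
      refine ⟨?_, fun _ => h1⟩
      rw [h1, w_even ((hpar j).mpr hj), mul_assoc, sub_mul, hκb]
      simp
  have w_a : ∀ j, w j * a = a * w (j + 1) ∧ (Even (j + s) → w j * a = 0) := by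
    intro j
    by_cases hj : Even (j + s)
    · have h1 : w j * a = 0 := by rw [w_even hj, mul_assoc, sub_mul, hκa]; simp
      refine ⟨?_, fun _ => h1⟩
      rw [h1, w_odd (by rwa [hpar, not_not]), hκe, ← mul_assoc, haκ, zero_mul]
    · refine ⟨?_, fun h' => absurd h' hj⟩
      rw [w_odd hj, w_even ((hpar j).mpr hj), mul_assoc, hκa, h.e_mul_a, mul_sub, hκe,
        mul_sub, ← mul_assoc a κ, haκ]
      simp
  -- the zigzag of linear relations
  let C : ℕ → Submodule k (V × V) := fun j =>
    if Even (i + j + s) then (LinearMap.range (w (i + j))).map (LinearMap.prod LinearMap.id b)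
    else (LinearMap.range (w (i + j + 1))).map (LinearMap.prod a LinearMap.id)
  have C_even : ∀ {j y z}, Even (i + j + s) →
      ((y, z) ∈ C j ↔ w (i + j) y = y ∧ z = b y) := by
    intro j y z hj
    simp only [C, if_pos hj]
    constructor
    · rintro ⟨_, ⟨t, rfl⟩, ht⟩
      obtain ⟨rfl, rfl⟩ := Prod.mk.inj ht
      exact ⟨LinearMap.congr_fun (w_w (i + j)) t, rfl⟩
    · rintro ⟨h1, rfl⟩
      exact ⟨y, ⟨y, h1⟩, rfl⟩
  have C_odd : ∀ {j y z}, ¬ Even (i + j + s) →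
      ((y, z) ∈ C j ↔ w (i + j + 1) z = z ∧ y = a z) := by
    intro j y z hj
    simp only [C, if_neg hj]
    constructor
    · rintro ⟨_, ⟨t, rfl⟩, ht⟩
      obtain ⟨rfl, rfl⟩ := Prod.mk.inj ht
      exact ⟨LinearMap.congr_fun (w_w (i + j + 1)) t, rfl⟩
    · rintro ⟨h1, rfl⟩
      exact ⟨z, ⟨z, h1⟩, rfl⟩
  have C_mem : ∀ {j y z}, (y, z) ∈ C j → w (i + j) y = y ∧ w (i + j + 1) z = z := by
    intro j y z hyz
    by_cases hj : Even (i + j + s)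
    · obtain ⟨h1, rfl⟩ := (C_even hj).mp hyz
      refine ⟨h1, ?_⟩
      have := LinearMap.congr_fun (w_b (i + j)).1 y
      simpa [h1] using this
    · obtain ⟨h1, rfl⟩ := (C_odd hj).mp hyz
      refine ⟨?_, h1⟩
      have := LinearMap.congr_fun (w_a (i + j)).1 z
      simpa [h1] using this
  have him : i ≤ m := by
    by_contra hlt
    exact hi (w_zero i (by omega))
  obtain ⟨l, hl, x, f, hx0, hxC, hfC, hfx, hend⟩ :=
    exists_chain_and_dual_chain (E := LinearMap.range (w i)) (C := C)
      (by rwa [ne_eq, LinearMap.range_eq_bot]) (L := m + 1 - i) (by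
        intro y z hyz
        -- After `m + 1 - i` steps a chain has reached degree `m + 1`, where the space is zero.
        obtain ⟨n, hn⟩ : ∃ n, m + 1 - i = n + 1 := ⟨m - i, by omega⟩
        rw [hn] at hyz
        obtain ⟨t, -, ht⟩ := hyz
        have := (C_mem ht).2
        rw [w_zero _ (by omega)] at this
        exact this.symm)
  have hwx : ∀ j ≤ l, w (i + j) (x j) = x j := by
    intro j hj
    rcases j with _ | j
    · obtain ⟨t, ht⟩ := hx0
      rw [← ht]; exact LinearMap.congr_fun (w_w i) t
    · exact (C_mem (hxC j (by omega))).2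
  -- The functionals are composed with `w j` because they are controlled only on the summands of the
  -- zigzag; this makes them homogeneous and zero on the other zigzag.
  refine ⟨i, i + l, s, fun j => if j ∈ Set.Icc i (i + l) then x (j - i) else 0,
    fun j => if j ∈ Set.Icc i (i + l) then (f (j - i)).comp (w j) else 0, by omega, by omega, hs,
    ?_, ?_, ?_, ?_, ?_, ?_, ?_, ?_⟩
  · intro j hj
    simp [hj]
  · rintro j ⟨h1, h2⟩
    obtain ⟨j, rfl⟩ := Nat.exists_eq_add_of_le h1
    have hmem : i + j ∈ Set.Icc i (i + l) := ⟨h1, h2⟩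
    simp only [if_pos hmem]
    rw [LinearMap.comp_apply, add_tsub_cancel_left,
      hwx j (by omega), hfx j (by omega)]
  · intro j' j
    by_cases hj : j ∈ Set.Icc i (i + l)
    · simp only [if_pos hj]
      obtain ⟨j, rfl⟩ := Nat.exists_eq_add_of_le hj.1
      have hjl : j ≤ l := by have := hj.2; omega
      have := LinearMap.congr_fun (e_w j' (i + j)) (x j)
      rw [Module.End.mul_apply, hwx j hjl] at this
      rw [add_tsub_cancel_left, this]
      split_ifs <;> simp [hwx j hjl]
    · simp [hj]
  · intro j' j v
    by_cases hj : j ∈ Set.Icc i (i + l)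
    · simp only [if_pos hj]
      rw [LinearMap.comp_apply, ← Module.End.mul_apply, w_comm, e_w]
      split_ifs <;> simp
    · simp [hj]
  · intro j hj
    obtain ⟨j, rfl⟩ := Nat.exists_eq_add_of_le hj.1
    have hjl : j ≤ l := by have := hj.2; omega
    simp only [if_pos hj, add_tsub_cancel_left]
    by_cases hp : Even (i + j + s)
    · rw [if_pos hp]
      by_cases hlt : j < l
      · rw [if_pos ⟨by omega, by omega⟩, add_assoc, add_tsub_cancel_left,
          ((C_even hp).mp (hxC j hlt)).2]
      · obtain rfl : j = l := by omega
        rw [if_neg (fun hc => by have := hc.2; omega)]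
        -- At the right end either `b` kills the last vector, or the last functional would vanish on
        -- it, contrary to `f l (x l) = 1`.
        rcases hend with hend | hend
        · exact ((C_even hp).mp hend).2.symm
        · have := hend (x j) (b (x j)) ((C_even hp).mpr ⟨hwx j le_rfl, rfl⟩)
          rw [hfx j le_rfl] at this
          exact absurd this one_ne_zero
    · rw [if_neg hp, ← hwx j hjl]
      exact LinearMap.congr_fun ((w_b (i + j)).2 hp) (x j)
  · intro j hj
    simp only [if_pos hj]
    by_cases hp : Even (j + 1 + s)
    · rw [if_pos hp]
      rcases hj.1.eq_or_lt with h1 | h1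
      · rw [if_neg (fun hc => by have := hc.1; omega), h1.symm, Nat.sub_self]
        have h3 : a (w (j + 1) (x 0)) = w j (a (x 0)) :=
          (LinearMap.congr_fun (w_a j).1 (x 0)).symm
        -- At the left end, `a` maps into a degree below `i`, where the zigzag is zero by minimality
        -- of `i`.
        rw [hmin j (by omega), ← h1, show w i (x 0) = x 0 from hwx 0 (by omega)] at h3
        exact h3
      · obtain ⟨j, rfl⟩ := Nat.exists_eq_add_of_le (show i ≤ j by omega)
        have hjl : j + 1 ≤ l := by have := hj.2; omega
        rw [if_pos ⟨by omega, by omega⟩, add_assoc, add_tsub_cancel_left, add_tsub_cancel_left]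
        exact ((C_odd ((hpar _).mp hp)).mp (hxC j (by omega))).2.symm
    · rw [if_neg hp]
      obtain ⟨n, hn⟩ := Nat.exists_eq_add_of_le hj.1
      have hjl : n ≤ l := by have := hj.2; omega
      have h3 : a (w (j + 1) (x n)) = w j (a (x n)) :=
        (LinearMap.congr_fun (w_a j).1 (x n)).symm
      have h4 := LinearMap.congr_fun ((w_a j).2 (by rwa [hpar, not_not] at hp)) (x n)
      rw [hn, add_tsub_cancel_left, ← hwx n hjl, ← hn, h3]
      exact h4
  · intro j v hj
    simp only [if_pos hj]
    rw [LinearMap.comp_apply, ← Module.End.mul_apply, (w_b j).1, Module.End.mul_apply]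
    by_cases hp : Even (j + s)
    · rw [if_neg (by rwa [hpar, not_not])]
      rcases hj.1.eq_or_lt with h1 | h1
      · rw [if_neg (fun hc => by have := hc.1; omega), hmin j (by omega)]
        simp
      · obtain ⟨j, rfl⟩ := Nat.exists_eq_add_of_le (show i ≤ j by omega)
        have hjl : j + 1 ≤ l := by have := hj.2; omega
        rw [if_pos ⟨by omega, by omega⟩, add_assoc, add_tsub_cancel_left, add_tsub_cancel_left,
          LinearMap.comp_apply]
        exact (hfC j (by omega) _ _ ((C_even hp).mpr
          ⟨LinearMap.congr_fun (w_w (i + j)) v, rfl⟩)).symm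
    · rw [if_pos ((hpar j).mpr hp), ← Module.End.mul_apply, (w_b j).2 hp]
      simp
  · intro j hj v
    obtain ⟨j, rfl⟩ := Nat.exists_eq_add_of_le hj.1
    have hjl : j ≤ l := by have := hj.2; omega
    simp only [if_pos hj, add_tsub_cancel_left]
    rw [LinearMap.comp_apply, ← Module.End.mul_apply]
    by_cases hp : Even (i + j + s)
    · rw [if_pos hp, (w_a _).2 hp]
      simp
    · rw [if_neg hp, (w_a _).1, Module.End.mul_apply]
      have hC : (a (w (i + j + 1) v), w (i + j + 1) v) ∈ C j :=
        (C_odd hp).mpr ⟨LinearMap.congr_fun (w_w (i + j + 1)) v, rfl⟩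
      by_cases hlt : j < l
      · rw [if_pos ⟨by omega, by omega⟩, LinearMap.comp_apply, add_assoc, add_tsub_cancel_left]
        exact hfC j hlt _ _ hC
      · obtain rfl : j = l := by omega
        rw [if_neg (fun hc => by have := hc.2; omega)]
        -- If `(x l, 0)` were in the relation, then `x l = a 0 = 0`, which is impossible; so the
        -- last functional vanishes on the image of `a`.
        rcases hend with hend | hend
        · have hz := ((C_odd hp).mp hend).2
          rw [map_zero] at hz
          have := hfx j le_rfl
          rw [hz, map_zero] at this
          exact absurd this zero_ne_one
        · exact hend _ _ hC

end Strings

end IsLadder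

/-! ### Modules over an algebra with given generators -/

section Generators

variable {k : Type*} [Field k] {A : Type*} [Ring A] [Algebra k A] {G : Set A}

theorem smul_mem_of_adjoin_eq_top (hG : Algebra.adjoin k G = ⊤) {N : Type*} [AddCommGroup N]
    [Module k N] [Module A N] [IsScalarTower k A N] {S : Submodule k N}
    (hS : ∀ g ∈ G, ∀ n ∈ S, g • n ∈ S) (x : A) {n : N} (hn : n ∈ S) : x • n ∈ S := by
  have hx : x ∈ Algebra.adjoin k G := hG ▸ Algebra.mem_top
  induction hx using Algebra.adjoin_induction generalizing n with
  | mem x hx => exact hS x hx n hn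
  | algebraMap r => rw [algebraMap_smul]; exact S.smul_mem r hn
  | add x y _ _ hx hy => rw [add_smul]; exact S.add_mem (hx hn) (hy hn)
  | mul x y _ _ hx hy => rw [mul_smul]; exact hx (hy hn)

/-- A linear bijection that commutes with generators is an isomorphism of modules. -/
theorem nonempty_linearEquiv_of_adjoin_eq_top (hG : Algebra.adjoin k G = ⊤) {N N' : Type*}
    [AddCommGroup N] [Module k N] [Module A N] [IsScalarTower k A N]
    [AddCommGroup N'] [Module k N'] [Module A N'] [IsScalarTower k A N'] (f : N ≃ₗ[k] N')
    (hf : ∀ g ∈ G, ∀ n, f (g • n) = g • f n) : Nonempty (N ≃ₗ[A] N') := by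
  have key : ∀ (x : A) (n : N), f (x • n) = x • f n := by
    intro x
    have hx : x ∈ Algebra.adjoin k G := hG ▸ Algebra.mem_top
    induction hx using Algebra.adjoin_induction with
    | mem x hx => exact hf x hx
    | algebraMap r => intro n; rw [algebraMap_smul, algebraMap_smul, map_smul]
    | add x y _ _ hx hy => intro n; rw [add_smul, add_smul, map_add, hx, hy]
    | mul x y _ _ hx hy => intro n; rw [mul_smul, mul_smul, hx, hy]
  exact ⟨{ f.toAddEquiv with map_smul' := key }⟩

/-- If a finite family of vectors of an indecomposable module spans a submodule and is dual to a
family of functionals whose common kernel is a submodule, then it is a basis. -/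
theorem IsIndecomposableModule.exists_basis (hG : Algebra.adjoin k G = ⊤) {N : Type*}
    [AddCommGroup N] [Module k N] [Module A N] [IsScalarTower k A N]
    (hN : IsIndecomposableModule A N) {ι : Type*} [Finite ι] [Nonempty ι] {x : ι → N}
    {c : ι → Module.Dual k N} (hself : ∀ i, c i (x i) = 1) (hne : ∀ i j, i ≠ j → c i (x j) = 0)
    (hx : ∀ g ∈ G, ∀ j, g • x j ∈ Submodule.span k (Set.range x))
    (hc : ∀ g ∈ G, ∀ n, (∀ i, c i n = 0) → ∀ i, c i (g • n) = 0) :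
    ∃ B : Module.Basis ι k N, ∀ j, B j = x j := by
  classical
  have := Fintype.ofFinite ι
  have : SMulCommClass A k N := IsScalarTower.to_smulCommClass'
  let S₁ : Submodule k N := Submodule.span k (Set.range x)
  let S₂ : Submodule k N := ⨅ i, LinearMap.ker (c i)
  have mem₂ : ∀ n, n ∈ S₂ ↔ ∀ i, c i n = 0 := by intro n; simp [S₂]
  have inv₁ : ∀ g ∈ G, ∀ n ∈ S₁, g • n ∈ S₁ := by
    intro g hg n hn
    induction hn using Submodule.span_induction with
    | mem n hn => obtain ⟨j, rfl⟩ := hn; exact hx g hg j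
    | zero => rw [smul_zero]; exact S₁.zero_mem
    | add y z _ _ hy hz => rw [smul_add]; exact S₁.add_mem hy hz
    | smul r y _ hy => rw [smul_comm]; exact S₁.smul_mem r hy
  have inv₂ : ∀ g ∈ G, ∀ n ∈ S₂, g • n ∈ S₂ := fun g hg n hn =>
    (mem₂ _).mpr (hc g hg n ((mem₂ n).mp hn))
  let N₁ : Submodule A N :=
    { S₁.toAddSubmonoid with smul_mem' := fun r _ hn => smul_mem_of_adjoin_eq_top hG inv₁ r hn }
  let N₂ : Submodule A N :=
    { S₂.toAddSubmonoid with smul_mem' := fun r _ hn => smul_mem_of_adjoin_eq_top hG inv₂ r hn }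
  have c_sum : ∀ (r : ι → k) (i : ι), c i (∑ j, r j • x j) = r i := by
    intro r i
    rw [map_sum, Finset.sum_eq_single i]
    · rw [map_smul, hself, smul_eq_mul, mul_one]
    · intro j _ hj; rw [map_smul, hne i j hj.symm, smul_zero]
    · simp
  have hcompl : IsCompl N₁ N₂ := by
    rw [isCompl_iff]
    constructor
    · rw [Submodule.disjoint_def]
      intro n h1 h2
      obtain ⟨r, rfl⟩ := (Submodule.mem_span_range_iff_exists_fun k).mp (show n ∈ S₁ from h1)
      have h3 := (mem₂ _).mp (show _ ∈ S₂ from h2)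
      exact Finset.sum_eq_zero fun i _ => by rw [← c_sum r i, h3 i, zero_smul]
    · rw [codisjoint_iff, eq_top_iff]
      intro n _
      rw [Submodule.mem_sup]
      -- The sum `∑ c j n • x j` is the projection onto the span of the dual family, along the
      -- common kernel.
      refine ⟨∑ j, c j n • x j, ?_, n - ∑ j, c j n • x j, ?_, by abel⟩
      · exact S₁.sum_mem fun j _ => S₁.smul_mem _ (Submodule.subset_span ⟨j, rfl⟩)
      · exact (mem₂ _).mpr fun i => by rw [map_sub, c_sum, sub_self]
  have hbot : N₂ = ⊥ := by
    refine (hN.2 N₁ N₂ hcompl).resolve_left fun h0 => ?_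
    obtain ⟨i⟩ := ‹Nonempty ι›
    have h1 : x i ∈ N₁ := Submodule.subset_span ⟨i, rfl⟩
    rw [h0, Submodule.mem_bot] at h1
    have := hself i
    rw [h1, map_zero] at this
    exact zero_ne_one this
  have hspan : ⊤ ≤ Submodule.span k (Set.range x) := by
    intro n _
    have : n ∈ N₁ := by
      have h1 : N₁ = ⊤ := by simpa [hbot] using hcompl.sup_eq_top
      rw [h1]; trivial
    exact this
  have hli : LinearIndependent k x := by
    rw [Fintype.linearIndependent_iff]
    intro r hr i
    rw [← c_sum r i, hr, map_zero]
  exact ⟨Module.Basis.mk hli hspan, fun j => by simp⟩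

end Generators

/-- Each label `δ` describes at most one isomorphism class, so one chosen module for each label is
enough. -/
theorem hasFiniteRepresentationType_of_finite_cover {k : Type u} [Field k] {A : Type v} [Ring A]
    [Algebra k A] {D : Type*} [Finite D] (P : D → ModuleCat.{u} A → Prop)
    (hP : ∀ (N : Type u) [AddCommGroup N] [Module k N] [Module A N] [IsScalarTower k A N],
      IsIndecomposableModule A N → ∃ δ, P δ (ModuleCat.of A N))
    (hiso : ∀ δ M M', P δ M → P δ M' → Nonempty (M ≃ₗ[A] M')) :
    HasFiniteRepresentationType k A := by
  classical
  obtain ⟨r, ⟨f⟩⟩ := Finite.exists_equiv_fin D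
  let M : D → ModuleCat.{u} A := fun δ =>
    -- A label without any module receives the zero module, which is never used.
    if h : ∃ M, P δ M then h.choose else ModuleCat.of A PUnit
  refine ⟨r, fun i => M (f.symm i), fun N _ _ _ _ _ hN => ?_⟩
  obtain ⟨δ, hδ⟩ := hP N hN
  have hex : ∃ M, P δ M := ⟨_, hδ⟩
  have hM : ∀ δ', δ' = δ → P δ (M δ') := by
    rintro _ rfl
    simp only [M, dif_pos hex]
    exact hex.choose_spec
  exact ⟨f δ, hiso δ _ _ hδ (hM _ (f.symm_apply_apply δ))⟩

/-! ### Representation type of algebras that are generated by a ladder -/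

section Ladder

variable (k : Type*) [Field k] {A : Type*} [Ring A] [Algebra k A] (e : ℕ → A) (a b : A)

/-- The module `N` has a basis `x i, …, x l` on which `a` and `b` act along a zigzag. -/
def HasStringBasis (i l s : ℕ) (N : Type*) [AddCommGroup N] [Module k N] [Module A N] : Prop :=
  ∃ x : ℕ → N, (∀ j, j ∉ Set.Icc i l → x j = 0) ∧
    (∃ B : Module.Basis (Set.Icc i l) k N, ∀ j, B j = x j) ∧
    (∀ j' j, e j' • x j = if j' = j then x j else 0) ∧
    (∀ j ∈ Set.Icc i l, b • x j = if Even (j + s) then x (j + 1) else 0) ∧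
    ∀ j, j + 1 ∈ Set.Icc i l → a • x (j + 1) = if Even (j + 1 + s) then x j else 0

/-- The module `N` has a basis of the form `x, ax, bx, abx` with `x` of degree `i`. -/
def HasDiamondBasis (i : ℕ) (N : Type*) [AddCommGroup N] [Module k N] [Module A N] : Prop :=
  ∃ x : N, (∀ j, e j • x = if j = i then x else 0) ∧
    ∃ B : Module.Basis (Fin 4) k N, ∀ t, B t = ![x, a • x, b • x, a • b • x] t

variable {k e a b} {m : ℕ} {N N' : Type*} [AddCommGroup N] [Module k N] [Module A N]
  [IsScalarTower k A N] [AddCommGroup N'] [Module k N'] [Module A N'] [IsScalarTower k A N']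

/-- The numbers `i`, `l`, `s` fix the action of all generators on the basis, so matching the two
bases is `A`-linear. -/
theorem HasStringBasis.nonempty_linearEquiv (h : IsLadder m e a b)
    (hgen : Algebra.adjoin k (Set.range e ∪ {a, b}) = ⊤) {i l s : ℕ}
    (hN : HasStringBasis k e a b i l s N) (hN' : HasStringBasis k e a b i l s N') :
    Nonempty (N ≃ₗ[A] N') := by
  obtain ⟨x, hx0, ⟨B, hB⟩, hex, hbx, hax⟩ := hN
  obtain ⟨x', hx0', ⟨B', hB'⟩, hex', hbx', hax'⟩ := hN'
  have : SMulCommClass A k N := IsScalarTower.to_smulCommClass'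
  have : SMulCommClass A k N' := IsScalarTower.to_smulCommClass'
  let f : N ≃ₗ[k] N' := B.equiv B' (Equiv.refl _)
  have hf : ∀ j, f (x j) = x' j := by
    intro j
    by_cases hj : j ∈ Set.Icc i l
    · rw [← hB ⟨j, hj⟩, ← hB' ⟨j, hj⟩]; simp [f]
    · rw [hx0 j hj, hx0' j hj, map_zero]
  refine nonempty_linearEquiv_of_adjoin_eq_top hgen f fun g hg n => ?_
  have key : f.toLinearMap ∘ₗ Algebra.lsmul k k N g = Algebra.lsmul k k N' g ∘ₗ f.toLinearMap := by
    refine B.ext fun ⟨j, hj⟩ => ?_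
    simp only [LinearMap.comp_apply, LinearEquiv.coe_coe, Algebra.lsmul_coe, hB, hf]
    rcases hg with ⟨j', rfl⟩ | rfl | rfl
    · rw [hex, hex']; split_ifs <;> simp [hf]
    · rcases j with _ | j
      -- The formula for `a` says nothing about `x 0`; there `a` is zero because `x 0 = e 0 • x 0`
      -- and `a * e 0 = 0`.
      · have h0 : g • x 0 = 0 := by
          have := hex 0 0
          rw [if_pos rfl] at this
          rw [← this, ← mul_smul, h.a_mul_e_zero, zero_smul]
        have h0' : g • x' 0 = 0 := by
          have := hex' 0 0
          rw [if_pos rfl] at this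
          rw [← this, ← mul_smul, h.a_mul_e_zero, zero_smul]
        rw [h0, h0', map_zero]
      · rw [hax j hj, hax' j hj]; split_ifs <;> simp [hf]
    · rw [hbx j hj, hbx' j hj]; split_ifs <;> simp [hf]
  exact LinearMap.congr_fun key n

-- The multiplication table of a diamond; it follows from the ladder relations and the degree of
-- `x`, so it needs no independence of the four vectors.
omit [Algebra k A] [Module k N] [IsScalarTower k A N] in
theorem IsLadder.smul_diamond (h : IsLadder m e a b) {i : ℕ} {x : N}
    (hx : ∀ j, e j • x = if j = i then x else 0) (j : ℕ) :
    e j • a • x = (if j + 1 = i then a • x else 0) ∧ e j • b • x = (if j = i + 1 then b • x else 0) ∧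
      e j • a • b • x = (if j = i then a • b • x else 0) ∧ a • a • x = 0 ∧ a • a • b • x = 0 ∧
      b • a • x = a • b • x ∧ b • b • x = 0 ∧ b • a • b • x = 0 := by
  refine ⟨?_, ?_, ?_, ?_, ?_, ?_, ?_, ?_⟩
  · rw [← mul_smul, h.e_mul_a, mul_smul, hx]; split_ifs <;> simp
  · rcases j with _ | j
    · rw [← mul_smul, h.e_zero_mul_b, zero_smul, if_neg (by omega)]
    · rw [← mul_smul, h.e_mul_b, mul_smul, hx]
      simp only [Nat.add_right_cancel_iff]
      split_ifs <;> simp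
  · rw [← mul_smul a, ← mul_smul, h.e_mul_ab, mul_smul, hx]; split_ifs <;> simp
  · rw [← mul_smul, h.a_mul_a, zero_smul]
  · rw [← mul_smul, h.a_mul_a, zero_smul]
  · rw [← mul_smul, ← h.comm, mul_smul]
  · rw [← mul_smul, h.b_mul_b, zero_smul]
  · rw [← mul_smul, ← h.comm, mul_smul, ← mul_smul b, h.b_mul_b, zero_smul, smul_zero]

theorem HasDiamondBasis.nonempty_linearEquiv (h : IsLadder m e a b)
    (hgen : Algebra.adjoin k (Set.range e ∪ {a, b}) = ⊤) {i : ℕ}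
    (hN : HasDiamondBasis k e a b i N) (hN' : HasDiamondBasis k e a b i N') :
    Nonempty (N ≃ₗ[A] N') := by
  obtain ⟨x, hx, B, hB⟩ := hN
  obtain ⟨x', hx', B', hB'⟩ := hN'
  have : SMulCommClass A k N := IsScalarTower.to_smulCommClass'
  have : SMulCommClass A k N' := IsScalarTower.to_smulCommClass'
  let f : N ≃ₗ[k] N' := B.equiv B' (Equiv.refl _)
  have hf : ∀ t, f (B t) = B' t := fun t => by simp [f]
  have hf0 : f x = x' := by simpa [hB, hB'] using hf 0
  have hf1 : f (a • x) = a • x' := by simpa [hB, hB'] using hf 1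
  have hf2 : f (b • x) = b • x' := by simpa [hB, hB'] using hf 2
  have hf3 : f (a • b • x) = a • b • x' := by simpa [hB, hB'] using hf 3
  refine nonempty_linearEquiv_of_adjoin_eq_top hgen f fun g hg n => ?_
  have key : f.toLinearMap ∘ₗ Algebra.lsmul k k N g = Algebra.lsmul k k N' g ∘ₗ f.toLinearMap := by
    refine B.ext fun t => ?_
    simp only [LinearMap.comp_apply, LinearEquiv.coe_coe, Algebra.lsmul_coe, hB]
    rcases hg with ⟨j, rfl⟩ | rfl | rfl
    · obtain ⟨h1, h2, h3, -⟩ := h.smul_diamond hx j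
      obtain ⟨h1', h2', h3', -⟩ := h.smul_diamond hx' j
      fin_cases t
      · simp only [Fin.zero_eta, Matrix.cons_val, hx, hx', hf0]; split_ifs <;> simp [hf0]
      · simp only [Fin.mk_one, Matrix.cons_val, h1, h1', hf1]; split_ifs <;> simp [hf1]
      · simp only [Fin.reduceFinMk, Matrix.cons_val, h2, h2', hf2]; split_ifs <;> simp [hf2]
      · simp only [Fin.reduceFinMk, Matrix.cons_val, h3, h3', hf3]; split_ifs <;> simp [hf3]
    · obtain ⟨-, -, -, h1, h2, -⟩ := h.smul_diamond hx 0
      obtain ⟨-, -, -, h1', h2', -⟩ := h.smul_diamond hx' 0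
      fin_cases t <;> simp [hf0, hf1, hf2, hf3, h1, h2, h1', h2']
    · obtain ⟨-, -, -, -, -, h1, h2, h3⟩ := h.smul_diamond hx 0
      obtain ⟨-, -, -, -, -, h1', h2', h3'⟩ := h.smul_diamond hx' 0
      fin_cases t <;> simp [hf0, hf1, hf2, hf3, h1, h2, h1', h2', h3, h3']
  exact LinearMap.congr_fun key n

/-- A diamond with nonzero bottom splits off. A functional that is `1` on `abx` and `0` on `x`
gives, by composition with `ab`, `b`, `a`, `1` and the projections to suitable degrees, functionals
dual to `x, ax, bx, abx`. The generators permute these functionals up to zeros, so their common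
kernel is a complementary submodule. -/
theorem HasDiamondBasis.of_smul_ne_zero (h : IsLadder m e a b)
    (hgen : Algebra.adjoin k (Set.range e ∪ {a, b}) = ⊤) (hN : IsIndecomposableModule A N) {v : N}
    (hv : a • b • v ≠ 0) : ∃ i ≤ m, HasDiamondBasis k e a b i N := by
  have : SMulCommClass A k N := IsScalarTower.to_smulCommClass'
  obtain ⟨i, hi⟩ : ∃ i, a • b • e i • v ≠ 0 := by
    by_contra! hno
    refine hv ?_
    rw [← one_smul A v, ← h.sum_e, Finset.sum_smul, Finset.smul_sum, Finset.smul_sum]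
    exact Finset.sum_eq_zero fun j _ => hno j
  have him : i ≤ m := by
    by_contra hlt
    rw [h.e_eq_zero i (by omega)] at hi
    simp at hi
  -- Degree `0` is excluded by `ab e_0 = b a e_0 = 0`; hence the neighbour `e n` below exists.
  obtain ⟨n, rfl⟩ : ∃ n, i = n + 1 := by
    rcases i with _ | n
    · refine absurd ?_ hi
      rw [← mul_smul, ← mul_smul, h.comm, mul_assoc, h.a_mul_e_zero, mul_zero, zero_smul]
    · exact ⟨n, rfl⟩
  let x : N := e (n + 1) • v
  have hx : ∀ j, e j • x = if j = n + 1 then x else 0 := by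
    intro j
    simp only [x]
    rw [← mul_smul, h.e_mul_e]
    split_ifs <;> simp
  obtain ⟨φ₁, hφ₁⟩ := Module.Projective.exists_dual_eq_one k hi
  let op : A →ₐ[k] Module.End k N := Algebra.lsmul k k N
  -- The correction term makes `φ x = 0` and leaves the value on `abx` unchanged, since `ab` kills
  -- `abx`.
  let φ : Module.Dual k N := φ₁ - φ₁ x • φ₁.comp (op (a * b))
  obtain ⟨-, -, -, haa, haab, hba, hbb, hbab⟩ := h.smul_diamond hx 0
  have hφ : φ (a • b • x) = 1 := by
    simp only [φ, op, LinearMap.sub_apply, LinearMap.smul_apply, LinearMap.comp_apply,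
      Algebra.lsmul_coe, mul_smul, hbab, smul_zero, map_zero, sub_zero]
    exact hφ₁
  have hφx : φ x = 0 := by
    simp only [φ, op, LinearMap.sub_apply, LinearMap.smul_apply, LinearMap.comp_apply,
      Algebra.lsmul_coe, mul_smul]
    rw [show φ₁ (a • b • x) = 1 from hφ₁]
    simp
  refine ⟨n + 1, him, x, hx, ?_⟩
  refine hN.exists_basis hgen (c := ![φ.comp (op (a * b * e (n + 1))), φ.comp (op (b * e n)),
    φ.comp (op (a * e (n + 2))), φ.comp (op (e (n + 1)))]) ?_ ?_ ?_ ?_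
  · intro t
    have h1 := (h.smul_diamond hx n).1
    have h2 := (h.smul_diamond hx (n + 2)).2.1
    have h3 := (h.smul_diamond hx (n + 1)).2.2.1
    fin_cases t <;> simp [op, hx, h1, h2, h3, hba, hφ]
  · intro s t hst
    have h0 := h.smul_diamond hx n
    have h1 := h.smul_diamond hx (n + 1)
    have h2 := h.smul_diamond hx (n + 2)
    fin_cases s <;> fin_cases t <;> first
      | exact absurd rfl hst
      | simp [op, hx, h0, h1, h2, hba, hφx, haa, haab, hbb, hbab]
  · intro g hg t
    have mem : ∀ t, ![x, a • x, b • x, a • b • x] t ∈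
        Submodule.span k (Set.range ![x, a • x, b • x, a • b • x]) :=
      fun t => Submodule.subset_span ⟨t, rfl⟩
    have m0 := mem 0
    have m1 := mem 1
    have m2 := mem 2
    have m3 := mem 3
    set S := Submodule.span k (Set.range ![x, a • x, b • x, a • b • x])
    simp only [Matrix.cons_val] at m0 m1 m2 m3
    rcases hg with ⟨j, rfl⟩ | rfl | rfl
    · obtain ⟨h1, h2, h3, -⟩ := h.smul_diamond hx j
      fin_cases t
      · simp only [Fin.zero_eta, Matrix.cons_val, hx]; split_ifs <;> simp [m0]
      · simp only [Fin.mk_one, Matrix.cons_val, h1]; split_ifs <;> simp [m1]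
      · simp only [Fin.reduceFinMk, Matrix.cons_val, h2]; split_ifs <;> simp [m2]
      · simp only [Fin.reduceFinMk, Matrix.cons_val, h3]; split_ifs <;> simp [m3]
    · fin_cases t <;> simp [m1, m3, haa, haab]
    · fin_cases t <;> simp [m2, m3, hba, hbb, hbab]
  · intro g hg y hy
    have y0 : φ (a • b • e (n + 1) • y) = 0 := by simpa [op, mul_smul] using hy 0
    have y1 : φ (b • e n • y) = 0 := by simpa [op, mul_smul] using hy 1
    have y2 : φ (a • e (n + 2) • y) = 0 := by simpa [op, mul_smul] using hy 2
    have y3 : φ (e (n + 1) • y) = 0 := by simpa [op, mul_smul] using hy 3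
    have ee : ∀ i j, e i • e j • y = if i = j then e j • y else 0 := by
      intro i j
      rw [← mul_smul, h.e_mul_e]
      split_ifs <;> simp
    have ea : ∀ j, e j • a • y = a • e (j + 1) • y := by
      intro j
      rw [← mul_smul, h.e_mul_a, mul_smul]
    have eb : ∀ j, e (j + 1) • b • y = b • e j • y := by
      intro j
      rw [← mul_smul, h.e_mul_b, mul_smul]
    have aa : ∀ z : N, a • a • z = 0 := fun z => by rw [← mul_smul, h.a_mul_a, zero_smul]
    have bb : ∀ z : N, b • b • z = 0 := fun z => by rw [← mul_smul, h.b_mul_b, zero_smul]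
    have ba : ∀ z : N, b • a • z = a • b • z := fun z => by
      rw [← mul_smul, ← h.comm, mul_smul]
    -- Moving the left `b` across `e n` avoids a case distinction: `n` may be `0`, and then `e n *
    -- b` has no shifted form.
    have beb : b • e n • b • y = 0 := by
      rw [← mul_smul, ← h.e_mul_b, mul_smul, bb, smul_zero]
    intro s
    rcases hg with ⟨j, rfl⟩ | rfl | rfl
    · fin_cases s <;> simp [op, ee] <;> split_ifs with hj <;>
        first | (subst hj; assumption) | simp
    · fin_cases s <;> simp [op, ea, aa, ba, y0, y2]
    · fin_cases s <;> simp [op, eb, bb, y0, y1, beb]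

/-- The ladder acts on `N` as a ladder of operators with `ab = 0`; the string that it contains is a
submodule with a complement, hence all of `N`. -/
theorem HasStringBasis.of_smul_eq_zero (h : IsLadder m e a b)
    (hgen : Algebra.adjoin k (Set.range e ∪ {a, b}) = ⊤) (hN : IsIndecomposableModule A N)
    (hab : ∀ v : N, a • b • v = 0) :
    ∃ i l s, i ≤ m ∧ l ≤ m ∧ s ≤ 1 ∧ HasStringBasis k e a b i l s N := by
  have := hN.1
  have : SMulCommClass A k N := IsScalarTower.to_smulCommClass'
  obtain ⟨i, l, s, x, c, hil, hlm, hs, hout, hself, hex, hce, hbx, hax, hcb, hca⟩ :=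
    (h.map (Algebra.lsmul k k N)).exists_string (LinearMap.ext fun v => hab v)
  simp only [Algebra.lsmul_coe] at hex hce hbx hax hcb hca
  refine ⟨i, l, s, hil.trans hlm, hlm, hs, x, fun j hj => (hout j hj).1, ?_, hex, hbx, hax⟩
  have : Nonempty (Set.Icc i l) := ⟨⟨i, le_rfl, hil⟩⟩
  refine hN.exists_basis hgen (x := fun j : Set.Icc i l => x j) (c := fun j => c j)
    (fun j => hself j j.2) ?_ ?_ ?_
  · rintro ⟨j, hj⟩ ⟨j', hj'⟩ hne
    have hne' : j ≠ j' := fun h0 => hne (Subtype.ext h0)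
    have h1 := hex j' j'
    rw [if_pos rfl] at h1
    dsimp only
    rw [← h1, hce, if_neg hne'.symm]
  · have mem : ∀ j, x j ∈ Submodule.span k (Set.range fun j : Set.Icc i l => x j) := by
      intro j
      by_cases hj : j ∈ Set.Icc i l
      · exact Submodule.subset_span ⟨⟨j, hj⟩, rfl⟩
      · rw [(hout j hj).1]; exact Submodule.zero_mem _
    rintro g hg ⟨j, hj⟩
    dsimp only
    rcases hg with ⟨j', rfl⟩ | rfl | rfl
    · rw [hex]; split_ifs
      exacts [mem j, Submodule.zero_mem _]
    · rcases j with _ | j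
      · have h1 := hex 0 0
        rw [if_pos rfl] at h1
        rw [← h1, ← mul_smul, h.a_mul_e_zero, zero_smul]
        exact Submodule.zero_mem _
      · rw [hax j hj]; split_ifs
        exacts [mem j, Submodule.zero_mem _]
    · rw [hbx j hj]; split_ifs
      exacts [mem _, Submodule.zero_mem _]
  · intro g hg n hn
    have hn' : ∀ j, c j n = 0 := by
      intro j
      by_cases hj : j ∈ Set.Icc i l
      · exact hn ⟨j, hj⟩
      · rw [(hout j hj).2, LinearMap.zero_apply]
    rintro ⟨j, hj⟩
    dsimp only
    rcases hg with ⟨j', rfl⟩ | rfl | rfl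
    · rw [hce, hn', ite_self]
    · rw [hca j hj, hn', ite_self]
    · rcases j with _ | j
      · have h1 := hce 0 0 (g • n)
        rw [if_pos rfl] at h1
        rw [← h1, ← mul_smul, h.e_zero_mul_b, zero_smul, map_zero]
      · rw [hcb j n hj, hn', ite_self]

end Ladder

/-- An algebra that is generated by a ladder has finite representation type. -/
theorem IsLadder.hasFiniteRepresentationType {k : Type u} [Field k] {A : Type v} [Ring A]
    [Algebra k A] {m : ℕ} {e : ℕ → A} {a b : A} (h : IsLadder m e a b)
    (hgen : Algebra.adjoin k (Set.range e ∪ {a, b}) = ⊤) : HasFiniteRepresentationType k A := by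
  -- The labels are the triples `(i, l, s)` for strings and the degrees `i` for diamonds. The
  -- predicate includes a compatible `k`-structure because an object of `ModuleCat A` comes without
  -- one.
  let P : (Fin (m + 1) × Fin (m + 1) × Fin 2) ⊕ Fin (m + 1) → ModuleCat.{u} A → Prop := fun δ M =>
    ∃ (_ : Module k M) (_ : IsScalarTower k A M),
      Sum.elim (fun t => HasStringBasis k e a b t.1 t.2.1 t.2.2 M)
        (fun i => HasDiamondBasis k e a b i M) δ
  refine hasFiniteRepresentationType_of_finite_cover P ?_ ?_
  · intro N _ _ _ _ hN
    by_cases hab : ∀ v : N, a • b • v = 0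
    · obtain ⟨i, l, s, hi, hl, hs, hstr⟩ := HasStringBasis.of_smul_eq_zero h hgen hN hab
      exact ⟨Sum.inl (⟨i, Nat.lt_succ_of_le hi⟩, ⟨l, Nat.lt_succ_of_le hl⟩,
        ⟨s, Nat.lt_succ_of_le hs⟩), inferInstanceAs (Module k N),
        inferInstanceAs (IsScalarTower k A N), hstr⟩
    · push Not at hab
      obtain ⟨v, hv⟩ := hab
      obtain ⟨i, hi, hd⟩ := HasDiamondBasis.of_smul_ne_zero h hgen hN hv
      exact ⟨Sum.inr ⟨i, Nat.lt_succ_of_le hi⟩, inferInstanceAs (Module k N),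
        inferInstanceAs (IsScalarTower k A N), hd⟩
  · rintro (t | i) M M' ⟨_, _, hM⟩ ⟨_, _, hM'⟩
    · exact HasStringBasis.nonempty_linearEquiv h hgen hM hM'
    · exact HasDiamondBasis.nonempty_linearEquiv h hgen hM hM'

/-! ### The universal property of the path algebra -/

namespace PathAlgebra

section Lift

variable {k : Type*} [Field k] {Q : Type*} [Quiver Q] {A : Type*} [Ring A] [Algebra k A]

/-- The product of the values `F f` along a path. -/
def pathValue (E : Q → A) (F : ∀ {x y : Q}, (x ⟶ y) → A) {x : Q} :
    ∀ {y : Q}, Quiver.Path x y → A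
  | _, .nil => E x
  | _, .cons p f => pathValue E F p * F f

/-- The trivial path in the middle is absorbed by `hFE` or by idempotence. As every value starts
with the factor `E x`, no condition `E x * F f = F f` is needed. -/
theorem pathValue_comp {E : Q → A} {F : ∀ {x y : Q}, (x ⟶ y) → A}
    (hEE : ∀ x, E x * E x = E x) (hFE : ∀ {x y : Q} (f : x ⟶ y), F f * E y = F f) {x y z : Q}
    (p : Quiver.Path x y) (q : Quiver.Path y z) :
    pathValue E F (p.comp q) = pathValue E F p * pathValue E F q := by
  induction q with
  | nil => cases p <;> simp [pathValue, hEE, hFE, mul_assoc]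
  | cons q f ih => simp [pathValue, ih, mul_assoc]

theorem mul_pathValue {E : Q → A} {F : ∀ {x y : Q}, (x ⟶ y) → A}
    (hEE : ∀ x, E x * E x = E x) {x y : Q} (p : Quiver.Path x y) :
    E x * pathValue E F p = pathValue E F p := by
  induction p with
  | nil => simp [pathValue, hEE]
  | cons q f ih => simp [pathValue, ← mul_assoc, ih]

theorem pathValue_mul {E : Q → A} {F : ∀ {x y : Q}, (x ⟶ y) → A}
    (hEE : ∀ x, E x * E x = E x) (hFE : ∀ {x y : Q} (f : x ⟶ y), F f * E y = F f) {x y : Q}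
    (p : Quiver.Path x y) : pathValue E F p * E y = pathValue E F p := by
  cases p <;> simp [pathValue, hEE, hFE, mul_assoc]

/-- The homomorphism from the path algebra that is given by orthogonal idempotents with sum `1` and
by compatible values of the arrows. -/
noncomputable def lift [Fintype Q] (E : Q → A) (F : ∀ {x y : Q}, (x ⟶ y) → A)
    (hsum : ∑ x, E x = 1) (hEE : ∀ x, E x * E x = E x) (hE : ∀ x y, x ≠ y → E x * E y = 0)
    (hFE : ∀ {x y : Q} (f : x ⟶ y), F f * E y = F f) : PathAlgebra k Q →ₐ[k] A :=
  AlgHom.ofLinearMap ((basis k).constr k fun x => pathValue E F x.2.2)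
    (by
      rw [one_def, map_sum, ← hsum]
      refine Finset.sum_congr rfl fun x _ => ?_
      rw [ofPath, Module.Basis.constr_basis]
      rfl)
    (by
      intro f g
      set L : PathAlgebra k Q →ₗ[k] A := (basis k).constr k fun x => pathValue E F x.2.2 with hL
      have hLp : ∀ {x y : Q} (p : Quiver.Path x y), L (ofPath k p) = pathValue E F p := by
        intro x y p
        rw [hL, ofPath, Module.Basis.constr_basis]
      have key : (mulLin k).compr₂ L = (LinearMap.mul k A).compl₁₂ L L := by
        refine (basis k).ext fun x => (basis k).ext fun y => ?_
        obtain ⟨x₁, x₂, p⟩ := x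
        obtain ⟨y₁, y₂, q⟩ := y
        change L (ofPath k p * ofPath k q) = L (ofPath k p) * L (ofPath k q)
        rw [hLp, hLp]
        by_cases h : x₂ = y₁
        · subst h
          rw [ofPath_mul_ofPath, hLp, pathValue_comp hEE hFE]
        · rw [ofPath_mul_ofPath_of_ne k _ _ h, map_zero, ← pathValue_mul hEE hFE p,
            ← mul_pathValue hEE q, mul_assoc, ← mul_assoc (E x₂), hE _ _ h, zero_mul, mul_zero]
      exact LinearMap.congr_fun (LinearMap.congr_fun key f) g)

theorem lift_ofPath [Fintype Q] (E : Q → A) (F : ∀ {x y : Q}, (x ⟶ y) → A)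
    (hsum : ∑ x, E x = 1) (hEE : ∀ x, E x * E x = E x) (hE : ∀ x y, x ≠ y → E x * E y = 0)
    (hFE : ∀ {x y : Q} (f : x ⟶ y), F f * E y = F f) {x y : Q} (p : Quiver.Path x y) :
    lift (k := k) E F hsum hEE hE hFE (ofPath k p) = pathValue E F p := by
  change (basis k).constr k (fun x => pathValue E F x.2.2) (basis k ⟨x, y, p⟩) = _
  rw [Module.Basis.constr_basis]

end Lift

end PathAlgebra

/-! ### The algebra `Ã_m` is generated by a ladder -/

section ATilde

variable (k : Type*) [Field k] (m : ℕ)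

/-- The number of a vertex. -/
def DoubledA.val {m : ℕ} (x : DoubledA m) : ℕ := Fin.val (n := m + 1) x

/-- The trivial path at the vertex `j`, and `0` if there is no such vertex. -/
noncomputable def vertexElt (j : ℕ) : PathAlgebra k (DoubledA m) :=
  if h : j < m + 1 then
    PathAlgebra.ofPath k (Quiver.Path.nil (a := show DoubledA m from (⟨j, h⟩ : Fin (m + 1))))
  else 0

theorem vertexElt_val (x : DoubledA m) : vertexElt k m x.val =
    PathAlgebra.ofPath k (Quiver.Path.nil : Quiver.Path x x) := dif_pos (Fin.is_lt (n := m + 1) x)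

variable {k m}

theorem vertexElt_mul_ofPath {x y : DoubledA m} (p : Quiver.Path x y)
    (j : ℕ) : vertexElt k m j * PathAlgebra.ofPath k p =
      if j = x.val then PathAlgebra.ofPath k p else 0 := by
  split_ifs with h
  · subst h
    rw [vertexElt_val, PathAlgebra.ofPath_mul_ofPath, Quiver.Path.nil_comp]
  · rw [vertexElt]
    split_ifs with hj
    · exact PathAlgebra.ofPath_mul_ofPath_of_ne k _ _ fun h0 => h (congrArg DoubledA.val h0)
    · exact zero_mul _

theorem ofPath_mul_vertexElt {x y : DoubledA m} (p : Quiver.Path x y)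
    (j : ℕ) : PathAlgebra.ofPath k p * vertexElt k m j =
      if j = y.val then PathAlgebra.ofPath k p else 0 := by
  split_ifs with h
  · subst h
    rw [vertexElt_val, PathAlgebra.ofPath_mul_ofPath, Quiver.Path.comp_nil]
  · rw [vertexElt]
    split_ifs with hj
    · exact PathAlgebra.ofPath_mul_ofPath_of_ne k _ _ fun h0 => h (congrArg DoubledA.val h0).symm
    · exact mul_zero _

theorem vertexElt_mul_alphaElt (j : ℕ) (i : Fin m) :
    vertexElt k m j * alphaElt k m i = if j = i then alphaElt k m i else 0 :=
  vertexElt_mul_ofPath (x := i.castSucc) (y := i.succ) _ j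

theorem alphaElt_mul_vertexElt (j : ℕ) (i : Fin m) :
    alphaElt k m i * vertexElt k m j = if j = i + 1 then alphaElt k m i else 0 :=
  ofPath_mul_vertexElt (x := i.castSucc) (y := i.succ) _ j

theorem vertexElt_mul_betaElt (j : ℕ) (i : Fin m) :
    vertexElt k m j * betaElt k m i = if j = i + 1 then betaElt k m i else 0 :=
  vertexElt_mul_ofPath (x := i.succ) (y := i.castSucc) _ j

theorem betaElt_mul_vertexElt (j : ℕ) (i : Fin m) :
    betaElt k m i * vertexElt k m j = if j = i then betaElt k m i else 0 :=
  ofPath_mul_vertexElt (x := i.succ) (y := i.castSucc) _ j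

theorem vertexElt_mul_vertexElt (i j : ℕ) :
    vertexElt k m i * vertexElt k m j = if i = j then vertexElt k m j else 0 := by
  by_cases hj : j < m + 1
  · obtain ⟨x, rfl⟩ : ∃ x : DoubledA m, j = x.val := ⟨(⟨j, hj⟩ : Fin (m + 1)), rfl⟩
    rw [vertexElt_val]
    exact vertexElt_mul_ofPath _ i
  · have : vertexElt k m j = 0 := dif_neg hj
    simp [this]

theorem alphaElt_mul_alphaElt {i j : Fin m} (h : (i : ℕ) + 1 ≠ j) :
    alphaElt k m i * alphaElt k m j = 0 :=
  PathAlgebra.ofPath_mul_ofPath_of_ne k _ _ fun h0 => h (congrArg DoubledA.val h0)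

theorem betaElt_mul_betaElt {i j : Fin m} (h : (j : ℕ) + 1 ≠ i) :
    betaElt k m i * betaElt k m j = 0 :=
  PathAlgebra.ofPath_mul_ofPath_of_ne k _ _ fun h0 => h (congrArg DoubledA.val h0).symm

theorem alphaElt_mul_betaElt {i j : Fin m} (h : i ≠ j) : alphaElt k m i * betaElt k m j = 0 :=
  PathAlgebra.ofPath_mul_ofPath_of_ne k _ _ fun h0 => h (Fin.succ_injective m h0)

theorem betaElt_mul_alphaElt {i j : Fin m} (h : i ≠ j) : betaElt k m i * alphaElt k m j = 0 :=
  PathAlgebra.ofPath_mul_ofPath_of_ne k _ _ fun h0 => h (Fin.castSucc_injective m h0)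

theorem sum_vertexElt : ∑ j ∈ Finset.range (m + 1), vertexElt k m j = 1 := by
  rw [Finset.sum_range, PathAlgebra.one_def]
  exact Finset.sum_congr rfl fun x _ => vertexElt_val k m x

variable (k m)

/-- The quotient map from the path algebra to `Ã_m`. -/
noncomputable def ATilde.mk : PathAlgebra k (DoubledA m) →ₐ[k] ATilde k m :=
  RingQuot.mkAlgHom k (ATildeRel k m)

/-- With paths composed from left to right, `α i` lies in `e_i A e_{i+1}`, so the sum of the `α` is
the lowering element and the sum of the `β` the raising one. In a product of two sums most terms
vanish because the arrows do not meet; the relations take care of the others. -/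
theorem ATilde.isLadder (hm : 1 ≤ m) : IsLadder m (fun j => ATilde.mk k m (vertexElt k m j))
    (ATilde.mk k m (∑ i, alphaElt k m i)) (ATilde.mk k m (∑ i, betaElt k m i)) := by
  have rel : ∀ {x y}, ATildeRel k m x y → ATilde.mk k m x = ATilde.mk k m y :=
    fun h => RingQuot.mkAlgHom_rel k h
  refine ⟨fun j hj => ?_, fun i j => ?_, ?_, fun j => ?_, fun j => ?_, ?_, ?_, ?_⟩
  · rw [vertexElt, dif_neg (by omega), map_zero]
  · rw [← map_mul, vertexElt_mul_vertexElt]; split_ifs <;> simp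
  · rw [← map_sum, sum_vertexElt, map_one]
  · rw [← map_mul, ← map_mul, Finset.mul_sum, Finset.sum_mul]
    congr 1
    refine Finset.sum_congr rfl fun i _ => ?_
    rw [vertexElt_mul_alphaElt, alphaElt_mul_vertexElt]
    simp only [Nat.add_right_cancel_iff]
  · rw [← map_mul, ← map_mul, Finset.mul_sum, Finset.sum_mul]
    congr 1
    refine Finset.sum_congr rfl fun i _ => ?_
    rw [vertexElt_mul_betaElt, betaElt_mul_vertexElt]
    simp only [Nat.add_right_cancel_iff]
  · rw [← map_mul, Finset.sum_mul_sum, map_sum]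
    refine Finset.sum_eq_zero fun i _ => ?_
    rw [map_sum]
    refine Finset.sum_eq_zero fun j _ => ?_
    by_cases h : (i : ℕ) + 1 = j
    · rw [rel (.alpha_alpha i j h), map_zero]
    · rw [alphaElt_mul_alphaElt h, map_zero]
  · rw [← map_mul, Finset.sum_mul_sum, map_sum]
    refine Finset.sum_eq_zero fun i _ => ?_
    rw [map_sum]
    refine Finset.sum_eq_zero fun j _ => ?_
    by_cases h : (j : ℕ) + 1 = i
    · rw [rel (.beta_beta j i h), map_zero]
    · rw [betaElt_mul_betaElt h, map_zero]
  · obtain ⟨n, rfl⟩ : ∃ n, m = n + 1 := ⟨m - 1, by omega⟩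
    have h1 : (∑ i, alphaElt k (n + 1) i) * ∑ i, betaElt k (n + 1) i =
        ∑ i, alphaElt k (n + 1) i * betaElt k (n + 1) i := by
      rw [Finset.sum_mul_sum]
      refine Finset.sum_congr rfl fun i _ => Finset.sum_eq_single i ?_ (by simp)
      exact fun j _ hj => alphaElt_mul_betaElt hj.symm
    have h2 : (∑ i, betaElt k (n + 1) i) * ∑ i, alphaElt k (n + 1) i =
        ∑ i, betaElt k (n + 1) i * alphaElt k (n + 1) i := by
      rw [Finset.sum_mul_sum]
      refine Finset.sum_congr rfl fun i _ => Finset.sum_eq_single i ?_ (by simp)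
      exact fun j _ hj => betaElt_mul_alphaElt hj.symm
    -- The sums of the `α i * β i` and of the `β i * α i` agree after a shift by one; the first term
    -- of one and the last term of the other are zero.
    rw [← map_mul, ← map_mul, h1, h2, Fin.sum_univ_succ, Fin.sum_univ_castSucc, map_add, map_add,
      rel (.alpha_beta_first 0 rfl), rel (.beta_alpha_last (Fin.last n) rfl), map_zero, zero_add,
      add_zero, map_sum, map_sum]
    exact Finset.sum_congr rfl fun i _ => (rel (.comm i.castSucc i.succ rfl)).symm

/-- The single arrows are recovered by cutting the sums with an idempotent: `α_i = e_i ∑ α` and `β_i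
= e_{i+1} ∑ β`. -/
theorem ATilde.adjoin_eq_top : Algebra.adjoin k
    (Set.range (fun j => ATilde.mk k m (vertexElt k m j)) ∪
      {ATilde.mk k m (∑ i, alphaElt k m i), ATilde.mk k m (∑ i, betaElt k m i)}) = ⊤ := by
  set S := Algebra.adjoin k (Set.range (fun j => ATilde.mk k m (vertexElt k m j)) ∪
      {ATilde.mk k m (∑ i, alphaElt k m i), ATilde.mk k m (∑ i, betaElt k m i)})
  have hv : ∀ j, ATilde.mk k m (vertexElt k m j) ∈ S :=
    fun j => Algebra.subset_adjoin (Or.inl ⟨j, rfl⟩)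
  have ha : ∀ i, ATilde.mk k m (alphaElt k m i) ∈ S := by
    intro i
    have : alphaElt k m i = vertexElt k m i * ∑ i, alphaElt k m i := by
      rw [Finset.mul_sum, Finset.sum_eq_single i]
      · rw [vertexElt_mul_alphaElt, if_pos rfl]
      · intro j _ hj
        rw [vertexElt_mul_alphaElt, if_neg fun h => hj (Fin.ext h.symm)]
      · simp
    rw [this, map_mul]
    exact S.mul_mem (hv i) (Algebra.subset_adjoin (Or.inr (Or.inl rfl)))
  have hb : ∀ i, ATilde.mk k m (betaElt k m i) ∈ S := by
    intro i
    have : betaElt k m i = vertexElt k m (i + 1) * ∑ i, betaElt k m i := by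
      rw [Finset.mul_sum, Finset.sum_eq_single i]
      · rw [vertexElt_mul_betaElt, if_pos rfl]
      · intro j _ hj
        rw [vertexElt_mul_betaElt, if_neg fun h => hj (Fin.ext (by omega))]
      · simp
    rw [this, map_mul]
    exact S.mul_mem (hv _) (Algebra.subset_adjoin (Or.inr (Or.inr rfl)))
  have hp : ∀ (x y : DoubledA m) (p : Quiver.Path x y),
      ATilde.mk k m (PathAlgebra.ofPath k p) ∈ S := by
    intro x y p
    induction p with
    | nil => exact vertexElt_val k m x ▸ hv x.val
    | cons p f ih =>
      have : PathAlgebra.ofPath k (p.cons f) = PathAlgebra.ofPath k p * PathAlgebra.ofArrow k f := by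
        rw [PathAlgebra.ofArrow, PathAlgebra.ofPath_mul_ofPath]; rfl
      rw [this, map_mul]
      refine S.mul_mem ih ?_
      change DoubledA.Arrow m _ _ at f
      cases f with
      | α i => exact ha i
      | β i => exact hb i
  rw [eq_top_iff]
  rintro x -
  obtain ⟨x, rfl⟩ := RingQuot.mkAlgHom_surjective k (ATildeRel k m) x
  have hx : x ∈ Submodule.span k (Set.range (PathAlgebra.basis k)) := by
    rw [Module.Basis.span_eq]; trivial
  change ATilde.mk k m x ∈ S
  induction hx using Submodule.span_induction with
  | mem x hx => obtain ⟨⟨x, y, p⟩, rfl⟩ := hx; exact hp x y p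
  | zero => rw [map_zero]; exact S.zero_mem
  | add x y _ _ hx hy => rw [map_add]; exact S.add_mem hx hy
  | smul r x _ hx => rw [map_smul]; exact S.smul_mem hx r

/-- A ladder in an algebra is the image of the ladder of `Ã_m` under a homomorphism. -/
theorem IsLadder.exists_algHom {A : Type*} [Ring A] [Algebra k A] {m : ℕ} {e : ℕ → A} {a b : A}
    (h : IsLadder m e a b) : ∃ f : ATilde k m →ₐ[k] A,
      (∀ j, f (ATilde.mk k m (vertexElt k m j)) = e j) ∧
      f (ATilde.mk k m (∑ i, alphaElt k m i)) = a ∧ f (ATilde.mk k m (∑ i, betaElt k m i)) = b := by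
  let E : DoubledA m → A := fun x => e x.val
  let F : ∀ {x y : DoubledA m}, (x ⟶ y) → A := fun {x y} f =>
    match x, y, f with
    | _, _, DoubledA.Arrow.α i => a * e (i + 1)
    | _, _, DoubledA.Arrow.β i => b * e i
  have hEE : ∀ x, E x * E x = E x := fun x => h.e_mul_self _
  have hE : ∀ x y, x ≠ y → E x * E y = 0 := fun x y hxy => by
    simp only [E]
    rw [h.e_mul_e, if_neg (show ¬ x.val = y.val from fun h0 => hxy (Fin.ext h0))]
  have hFE : ∀ {x y : DoubledA m} (f : x ⟶ y), F f * E y = F f := by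
    intro x y f
    change DoubledA.Arrow m x y at f
    cases f with
    | α i => exact (mul_assoc _ _ _).trans (congrArg (a * ·) (h.e_mul_self (i + 1)))
    | β i => exact (mul_assoc _ _ _).trans (congrArg (b * ·) (h.e_mul_self i))
  have hsum : ∑ x, E x = 1 := by
    rw [← h.sum_e, Finset.sum_range]
    rfl
  let Φ : PathAlgebra k (DoubledA m) →ₐ[k] A := PathAlgebra.lift E F hsum hEE hE hFE
  have hΦ : ∀ {x y : DoubledA m} (p : Quiver.Path x y),
      Φ (PathAlgebra.ofPath k p) = PathAlgebra.pathValue E F p :=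
    PathAlgebra.lift_ofPath E F hsum hEE hE hFE
  have hΦv : ∀ j, Φ (vertexElt k m j) = e j := by
    intro j
    by_cases hj : j < m + 1
    · rw [vertexElt, dif_pos hj, hΦ]; rfl
    · rw [vertexElt, dif_neg hj, map_zero, h.e_eq_zero j (by omega)]
  have hΦa : ∀ i, Φ (alphaElt k m i) = a * e (i + 1) := by
    intro i
    have : Φ (alphaElt k m i) = e i * (a * e (i + 1)) := hΦ _
    rw [this, ← h.e_mul_a, ← mul_assoc, h.e_mul_self]
  have hΦb : ∀ i, Φ (betaElt k m i) = b * e i := by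
    intro i
    have : Φ (betaElt k m i) = e (i + 1) * (b * e i) := hΦ _
    rw [this, ← h.e_mul_b, ← mul_assoc, h.e_mul_self]
  have aa : ∀ i j, a * e i * (a * e j) = 0 := fun i j => by
    rcases i with _ | i
    · rw [h.a_mul_e_zero, zero_mul]
    · rw [← h.e_mul_a, mul_assoc, ← mul_assoc a, h.a_mul_a]; simp
  have bb : ∀ i j, b * e i * (b * e j) = 0 := fun i j => by
    rw [← h.e_mul_b, mul_assoc, ← mul_assoc b, h.b_mul_b]; simp
  have ab : ∀ i, a * e (i + 1) * (b * e i) = a * b * e i := fun i => by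
    rw [mul_assoc, ← mul_assoc (e (i + 1)), h.e_mul_b, mul_assoc, h.e_mul_self, mul_assoc]
  have ba : ∀ i, b * e i * (a * e (i + 1)) = a * b * e (i + 1) := fun i => by
    rw [mul_assoc, ← mul_assoc (e i), h.e_mul_a, mul_assoc, h.e_mul_self, h.comm, mul_assoc]
  refine ⟨RingQuot.liftAlgHom k ⟨Φ, ?_⟩, ?_, ?_, ?_⟩
  · intro x y hxy
    cases hxy with
    | alpha_alpha i j hij => rw [map_mul, hΦa, hΦa, aa, map_zero]
    | beta_beta i j hij => rw [map_mul, hΦb, hΦb, bb, map_zero]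
    | alpha_beta_first i hi =>
      rw [map_mul, hΦa, hΦb, ab, hi, h.comm, mul_assoc, h.a_mul_e_zero, mul_zero, map_zero]
    | beta_alpha_last i hi =>
      rw [map_mul, hΦa, hΦb, ba, mul_assoc, ← h.e_mul_b, h.e_eq_zero _ (by omega), zero_mul,
        mul_zero, map_zero]
    | comm i j hij => rw [map_mul, map_mul, hΦb, hΦa, hΦa, hΦb, ab, ba, hij]
  · intro j
    rw [ATilde.mk, RingQuot.liftAlgHom_mkAlgHom_apply, hΦv]
  · rw [ATilde.mk, RingQuot.liftAlgHom_mkAlgHom_apply, map_sum]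
    -- In `a = ∑ a * e j` the term `a * e 0`, which belongs to no arrow, vanishes.
    conv_rhs => rw [← mul_one a, ← h.sum_e, Finset.sum_range_succ', mul_add, h.a_mul_e_zero,
      add_zero, Finset.mul_sum, Finset.sum_range]
    exact Finset.sum_congr rfl fun i _ => hΦa i
  · rw [ATilde.mk, RingQuot.liftAlgHom_mkAlgHom_apply, map_sum]
    -- Likewise the term `b * e m = e (m + 1) * b` vanishes.
    conv_rhs => rw [← mul_one b, ← h.sum_e, Finset.sum_range_succ, mul_add, ← h.e_mul_b,
      h.e_eq_zero (m + 1) (by omega), zero_mul, add_zero, Finset.mul_sum, Finset.sum_range]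
    exact Finset.sum_congr rfl fun i _ => hΦb i

/-- An algebra that is generated by a ladder without unexpected relations is isomorphic to `Ã_m`. -/
theorem IsLadder.nonempty_algEquiv_ATilde {A : Type*} [Ring A] [Algebra k A] {m : ℕ} {e : ℕ → A}
    {a b : A} (hm : 2 ≤ m) (h : IsLadder m e a b)
    (hgen : Algebra.adjoin k (Set.range e ∪ {a, b}) = ⊤)
    (hne : ∀ j, 0 < j → j < m → a * b * e j ≠ 0) : Nonempty (A ≃ₐ[k] ATilde k m) := by
  obtain ⟨f, he, ha, hb⟩ := h.exists_algHom k
  have hinj : Function.Injective f :=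
    (ATilde.isLadder k m (by omega)).injective_of_ne_zero hm (ATilde.adjoin_eq_top k m) f
      (by rw [ha, hb]; simpa only [he] using hne)
  have hsurj : Function.Surjective f := by
    rw [← AlgHom.range_eq_top, eq_top_iff, ← hgen]
    refine Algebra.adjoin_le ?_
    rintro _ (⟨j, rfl⟩ | rfl | rfl)
    exacts [⟨_, he j⟩, ⟨_, ha⟩, ⟨_, hb⟩]
  exact ⟨(AlgEquiv.ofBijective f ⟨hinj, hsurj⟩).symm⟩

end ATilde

/-! ### Signs -/

section Signs

variable {d : ℕ}

theorem index_ext {x y : Fin 1 ⊕ Fin 1} (h : IsOddIndex x ↔ IsOddIndex y) : x = y := by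
  revert x y
  decide

/-- The index `i` with the parity of the entry at `a` changed. -/
def flipAt (i : Fin d → Fin 1 ⊕ Fin 1) (a b : Fin d) : Fin 1 ⊕ Fin 1 :=
  if b = a then Sum.swap (i b) else i b

theorem isOddIndex_flipAt_self (i : Fin d → Fin 1 ⊕ Fin 1) (a : Fin d) :
    IsOddIndex (flipAt i a a) ↔ ¬ IsOddIndex (i a) := by
  rw [flipAt, if_pos rfl]
  generalize i a = x
  revert x
  decide

theorem flipAt_of_ne (i : Fin d → Fin 1 ⊕ Fin 1) {a b : Fin d} (h : b ≠ a) :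
    flipAt i a b = i b := if_neg h

theorem flipAt_self_ne (i : Fin d → Fin 1 ⊕ Fin 1) (a : Fin d) : flipAt i a a ≠ i a := by
  intro h
  have := isOddIndex_flipAt_self i a
  rw [h] at this
  tauto

theorem eq_flipAt_self_of_ne {i : Fin d → Fin 1 ⊕ Fin 1} {a : Fin d} {x : Fin 1 ⊕ Fin 1}
    (h : x ≠ i a) : x = flipAt i a a := by
  refine index_ext ?_
  rw [isOddIndex_flipAt_self]
  by_contra h'
  exact h (index_ext (by tauto))

theorem flipAt_flipAt_self (i : Fin d → Fin 1 ⊕ Fin 1) (a : Fin d) :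
    flipAt (flipAt i a) a = i := by
  funext b
  by_cases h : b = a
  · simp [flipAt, h]
  · simp [flipAt, h]

theorem flipAt_comm (i : Fin d → Fin 1 ⊕ Fin 1) (a b : Fin d) :
    flipAt (flipAt i a) b = flipAt (flipAt i b) a := by
  rcases eq_or_ne a b with rfl | hab
  · rfl
  funext c
  by_cases h : c = a <;> by_cases h' : c = b <;> simp [flipAt, h, h', hab, hab.symm]

theorem flipAt_injective (i : Fin d → Fin 1 ⊕ Fin 1) : Function.Injective (flipAt i) := by
  intro a b h
  by_contra hab
  have := congrFun h a
  rw [flipAt_of_ne i hab] at this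
  exact flipAt_self_ne i a this

theorem flipAt_comp (i : Fin d → Fin 1 ⊕ Fin 1) (σ : Equiv.Perm (Fin d)) (a : Fin d) :
    flipAt i (σ a) ∘ σ = flipAt (i ∘ σ) a := by
  funext b
  simp [flipAt]

/-- The number of odd entries of an index. -/
def oddCount (i : Fin d → Fin 1 ⊕ Fin 1) : ℕ := (Finset.univ.filter fun a => IsOddIndex (i a)).card

theorem oddCount_comp (i : Fin d → Fin 1 ⊕ Fin 1) (σ : Equiv.Perm (Fin d)) :
    oddCount (i ∘ σ) = oddCount i := by
  refine Finset.card_bij (fun a _ => σ a) ?_ ?_ ?_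
  · intro a ha; simpa using ha
  · intro a _ b _ h; exact σ.injective h
  · intro b hb; exact ⟨σ.symm b, by simpa using hb, by simp⟩

theorem oddCount_flipAt {i : Fin d → Fin 1 ⊕ Fin 1} {a : Fin d} (h : ¬ IsOddIndex (i a)) :
    oddCount (flipAt i a) = oddCount i + 1 := by
  have : (Finset.univ.filter fun b => IsOddIndex (flipAt i a b)) =
      insert a (Finset.univ.filter fun b => IsOddIndex (i b)) := by
    ext b
    by_cases hb : b = a
    · subst hb; simp [isOddIndex_flipAt_self, h]
    · simp [flipAt_of_ne i hb, hb]
  rw [oddCount, this, Finset.card_insert_of_notMem (by simp [h]), oddCount]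

theorem oddCount_flipAt_of_odd {i : Fin d → Fin 1 ⊕ Fin 1} {a : Fin d} (h : IsOddIndex (i a)) :
    oddCount (flipAt i a) + 1 = oddCount i := by
  rw [← oddCount_flipAt (i := flipAt i a) (a := a) (by rw [isOddIndex_flipAt_self]; tauto),
    flipAt_flipAt_self]

theorem oddCount_le (i : Fin d → Fin 1 ⊕ Fin 1) : oddCount i ≤ d :=
  (Finset.card_le_univ _).trans (by simp)

theorem exists_oddCount_eq {j : ℕ} (hj : j ≤ d) : ∃ i : Fin d → Fin 1 ⊕ Fin 1, oddCount i = j := by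
  obtain ⟨s, -, hs⟩ := Finset.exists_subset_card_eq (s := (Finset.univ : Finset (Fin d)))
    (n := j) (by simpa using hj)
  refine ⟨fun a => if a ∈ s then Sum.inr 0 else Sum.inl 0, ?_⟩
  rw [oddCount, ← hs]
  congr 1
  ext a
  simp only [Finset.mem_filter, Finset.mem_univ, true_and]
  split_ifs with h <;> simp [h, IsOddIndex]

theorem exists_comp_eq {i j : Fin d → Fin 1 ⊕ Fin 1} (h : oddCount i = oddCount j) :
    ∃ σ : Equiv.Perm (Fin d), j ∘ σ = i := by
  have hc : Fintype.card {a // IsOddIndex (i a)} = Fintype.card {a // IsOddIndex (j a)} := by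
    rw [Fintype.card_subtype, Fintype.card_subtype]; exact h
  let e := Fintype.equivOfCardEq hc
  refine ⟨e.extendSubtype, funext fun a => index_ext ⟨fun h' => ?_, fun h' => ?_⟩⟩
  · by_contra ha
    exact e.extendSubtype_not_mem a ha h'
  · exact e.extendSubtype_mem a h'

/-- The sign of moving an odd vector from the left to position `a`. -/
def signBefore (i : Fin d → Fin 1 ⊕ Fin 1) (a : Fin d) : ℤˣ :=
  ∏ b, if b < a ∧ IsOddIndex (i b) then -1 else 1

/-- A flip at `a` is felt only by later positions; this asymmetry makes flips at different positions
anticommute. -/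
theorem signBefore_flipAt (i : Fin d → Fin 1 ⊕ Fin 1) (a b : Fin d) :
    signBefore (flipAt i a) b = (if a < b then -1 else 1) * signBefore i b := by
  rw [← Int.units_inv_eq_self (signBefore i b), eq_mul_inv_iff_mul_eq, signBefore, signBefore,
    ← Finset.prod_mul_distrib]
  have : ∀ c, ((if c < b ∧ IsOddIndex (flipAt i a c) then -1 else 1) *
      (if c < b ∧ IsOddIndex (i c) then -1 else 1) : ℤˣ) =
      if c = a then (if a < b then -1 else 1) else 1 := by
    intro c
    by_cases hc : c = a
    · subst hc
      simp only [isOddIndex_flipAt_self]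
      by_cases h1 : c < b <;> by_cases h2 : IsOddIndex (i c) <;> simp [h1, h2]
    · rw [flipAt_of_ne i hc, if_neg hc]
      split_ifs <;> simp
  rw [Finset.prod_congr rfl fun c _ => this c, Finset.prod_ite_eq' Finset.univ a]
  simp

/-- This sign identity is the equivariance of the flip operators. A flip at `σ a` affects
`superSign` only through the pairs containing `a`: an odd position `c` contributes when `σ` inverts
`c` and `a`, that is, when it precedes exactly one of `a` and `σ a` in the respective order. -/
theorem signBefore_comp (i : Fin d → Fin 1 ⊕ Fin 1) (σ : Equiv.Perm (Fin d)) (a : Fin d) :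
    superSign (flipAt i (σ a)) σ * signBefore i (σ a) =
      superSign i σ * signBefore (i ∘ σ) a := by
  suffices h : superSign (flipAt i (σ a)) σ * superSign i σ =
      signBefore (i ∘ σ) a * signBefore i (σ a) by
    have h1 := congrArg (· * superSign i σ * signBefore i (σ a)) h
    simp only [mul_assoc, Int.units_mul_self, mul_one] at h1
    rw [mul_comm (superSign i σ) (signBefore i (σ a)), ← mul_assoc (signBefore i (σ a)),
      Int.units_mul_self, one_mul] at h1
    rw [mul_comm (superSign i σ) (signBefore (i ∘ σ) a), ← h1]
  have hb : signBefore i (σ a) = ∏ c, if σ c < σ a ∧ IsOddIndex (i (σ c)) then -1 else 1 := by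
    rw [signBefore, ← Equiv.prod_comp σ]
  rw [hb, signBefore, ← Finset.prod_mul_distrib, superSign_eq_prod, superSign_eq_prod,
    ← Finset.prod_mul_distrib]
  -- `f` and `g` collect the inverted pairs in which `a` is the first, respectively the second,
  -- entry.
  let f : Fin d → ℤˣ := fun y => if a < y ∧ σ y < σ a ∧ IsOddIndex (i (σ y)) then -1 else 1
  let g : Fin d → ℤˣ := fun x => if x < a ∧ σ a < σ x ∧ IsOddIndex (i (σ x)) then -1 else 1
  have step : ∏ x ∈ Finset.univ.filter (fun x : Fin d × Fin d => x.1 < x.2),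
      ((if σ x.2 < σ x.1 ∧ IsOddIndex (flipAt i (σ a) (σ x.1)) ∧
          IsOddIndex (flipAt i (σ a) (σ x.2)) then -1 else 1) *
        (if σ x.2 < σ x.1 ∧ IsOddIndex (i (σ x.1)) ∧ IsOddIndex (i (σ x.2)) then -1 else 1) : ℤˣ) =
      ∏ x : Fin d × Fin d, (if x.1 = a then f x.2 else 1) * (if x.2 = a then g x.1 else 1) := by
    rw [Finset.prod_filter]
    refine Finset.prod_congr rfl ?_
    rintro ⟨x, y⟩ -
    dsimp only [f, g]
    by_cases hxa : x = a
    · subst hxa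
      by_cases hyx : y = x
      · subst hyx; simp
      · rw [flipAt_of_ne i (a := σ x) (b := σ y) (fun h => hyx (σ.injective h)), if_pos rfl,
          if_neg hyx, mul_one]
        simp only [isOddIndex_flipAt_self]
        by_cases h1 : x < y <;> by_cases h2 : σ y < σ x <;> by_cases h3 : IsOddIndex (i (σ x)) <;>
          by_cases h4 : IsOddIndex (i (σ y)) <;> simp [h1, h2, h3, h4]
    · rw [if_neg hxa, one_mul, flipAt_of_ne i (a := σ a) (b := σ x)
          (fun h => hxa (σ.injective h))]
      by_cases hya : y = a
      · subst hya
        rw [if_pos rfl]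
        simp only [isOddIndex_flipAt_self]
        by_cases h1 : x < y <;> by_cases h2 : σ y < σ x <;> by_cases h3 : IsOddIndex (i (σ x)) <;>
          by_cases h4 : IsOddIndex (i (σ y)) <;> simp [h1, h2, h3, h4]
      · rw [flipAt_of_ne i (a := σ a) (b := σ y) (fun h => hya (σ.injective h)), if_neg hya]
        split_ifs <;> simp
  rw [step, Finset.prod_mul_distrib, Fintype.prod_prod_type, Fintype.prod_prod_type_right]
  have e1 : ∏ x, ∏ y, (if x = a then f y else 1) = ∏ y, f y := by
    rw [Finset.prod_eq_single a]
    · simp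
    · intro x _ hx; simp [hx]
    · simp
  have e2 : ∏ y, ∏ x, (if y = a then g x else 1) = ∏ x, g x := by
    rw [Finset.prod_eq_single a]
    · simp
    · intro x _ hx; simp [hx]
    · simp
  rw [e1, e2, ← Finset.prod_mul_distrib]
  refine Finset.prod_congr rfl fun c _ => ?_
  dsimp only [f, g, Function.comp_apply]
  by_cases ho : IsOddIndex (i (σ c))
  · rcases lt_trichotomy c a with h1 | rfl | h1
    · rcases lt_or_gt_of_ne (fun h => h1.ne (σ.injective h) : σ c ≠ σ a) with h2 | h2 <;>
        simp [ho, h1, h2, not_lt_of_gt h1, not_lt_of_gt h2]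
    · simp
    · rcases lt_or_gt_of_ne (fun h => h1.ne' (σ.injective h) : σ c ≠ σ a) with h2 | h2 <;>
        simp [ho, h1, h2, not_lt_of_gt h1, not_lt_of_gt h2]
  · simp [ho]

theorem comp_swap_eq {i : Fin d → Fin 1 ⊕ Fin 1} {a b : Fin d} (h : i a = i b) :
    i ∘ Equiv.swap a b = i := by
  funext c
  rw [Function.comp_apply, Equiv.swap_apply_def]
  split_ifs with h1 h2
  · rw [h1, h]
  · rw [h2, h]
  · rfl

theorem superSign_swap_of_even {i : Fin d → Fin 1 ⊕ Fin 1} {a b : Fin d} (ha : ¬ IsOddIndex (i a))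
    (hb : ¬ IsOddIndex (i b)) : superSign i (Equiv.swap a b) = 1 := by
  have : oddInversions i (Equiv.swap a b) = ∅ := by
    refine Finset.filter_eq_empty_iff.mpr ?_
    rintro ⟨x, y⟩ - ⟨h1, h2, h3, h4⟩
    have key : ∀ z, IsOddIndex (i (Equiv.swap a b z)) → Equiv.swap a b z = z := by
      intro z hz
      refine Equiv.swap_apply_of_ne_of_ne ?_ ?_
      · rintro rfl; rw [Equiv.swap_apply_left] at hz; exact hb hz
      · rintro rfl; rw [Equiv.swap_apply_right] at hz; exact ha hz
    dsimp only at h1 h2 h3 h4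
    rw [key x h3, key y h4] at h2
    exact lt_asymm h1 h2
  simp [superSign, this]

/-- The positions need not be adjacent, so inversions are not counted. Instead both entries are made
even, where the sign is `1`, and flipped back one at a time with `signBefore_comp`; of the two
position signs, exactly one changes. -/
theorem superSign_swap_of_odd {i : Fin d → Fin 1 ⊕ Fin 1} {a b : Fin d} (hab : a ≠ b)
    (ha : IsOddIndex (i a)) (hb : IsOddIndex (i b)) : superSign i (Equiv.swap a b) = -1 := by
  obtain ⟨j, rfl⟩ : ∃ j, i = flipAt (flipAt j a) b :=
    ⟨flipAt (flipAt i a) b, by rw [flipAt_comm i, flipAt_flipAt_self, flipAt_flipAt_self]⟩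
  rw [flipAt_of_ne _ hab, isOddIndex_flipAt_self] at ha
  rw [flipAt_comm, flipAt_of_ne _ hab.symm, isOddIndex_flipAt_self] at hb
  have hj : j ∘ Equiv.swap a b = j :=
    comp_swap_eq (index_ext (iff_of_false ha hb))
  have h1 := signBefore_comp (flipAt j a) (Equiv.swap a b) a
  have h2 := signBefore_comp j (Equiv.swap a b) b
  have hc := flipAt_comp j (Equiv.swap a b) b
  rw [Equiv.swap_apply_right] at h2 hc
  rw [Equiv.swap_apply_left, hc, hj] at h1
  rw [superSign_swap_of_even ha hb, one_mul, hj] at h2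
  rw [signBefore_flipAt, signBefore_flipAt] at h1
  revert h1 h2
  generalize superSign (flipAt (flipAt j a) b) (Equiv.swap a b) = s
  generalize superSign (flipAt j a) (Equiv.swap a b) = t
  rcases lt_or_gt_of_ne hab with h | h <;>
    simp only [h, not_lt_of_gt h, if_true, if_false] <;>
    rcases Int.units_eq_one_or (signBefore j a) with e1 | e1 <;>
    rcases Int.units_eq_one_or (signBefore j b) with e2 | e2 <;>
    rw [e1, e2] <;> rcases Int.units_eq_one_or s with rfl | rfl <;>
    rcases Int.units_eq_one_or t with rfl | rfl <;> decide

end Signs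

/-! ### Creation and annihilation operators on tensor space -/

section Operators

variable (k : Type*) [Field k] (d : ℕ)

local notation "𝐓" => Module.End k (TensorSpace k 1 1 d)
local notation "𝐁" => tensorBasis k 1 1 d

/-- The odd operator that changes the parity of the `a`-th tensor factor. -/
noncomputable def flipOp (a : Fin d) : 𝐓 :=
  (𝐁).constr k fun i => ((signBefore i a : ℤˣ) : ℤ) • 𝐁 (flipAt i a)

/-- The projection onto the tensors that are odd in the `a`-th factor. -/
noncomputable def oddProj (a : Fin d) : 𝐓 :=
  (𝐁).constr k fun i => if IsOddIndex (i a) then 𝐁 i else 0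

/-- The projection onto the tensors with `j` odd factors. -/
noncomputable def degProj (j : ℕ) : 𝐓 :=
  (𝐁).constr k fun i => if oddCount i = j then 𝐁 i else 0

/-- The parity operator. -/
noncomputable def parityOp : 𝐓 :=
  (𝐁).constr k fun i => ((-1 : ℤ) ^ oddCount i) • 𝐁 i

/-- Multiplication by the sum of the odd generators. -/
noncomputable def raiseOp : 𝐓 := ∑ a, flipOp k d a * (1 - oddProj k d a)

/-- Contraction with the sum of the coordinates. -/
noncomputable def lowerOp : 𝐓 := ∑ a, flipOp k d a * oddProj k d a

variable {k d}

theorem flipOp_basis (a : Fin d) (i : Fin d → Fin 1 ⊕ Fin 1) :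
    flipOp k d a (𝐁 i) = ((signBefore i a : ℤˣ) : ℤ) • 𝐁 (flipAt i a) := by
  rw [flipOp, Module.Basis.constr_basis]

theorem oddProj_basis (a : Fin d) (i : Fin d → Fin 1 ⊕ Fin 1) :
    oddProj k d a (𝐁 i) = if IsOddIndex (i a) then 𝐁 i else 0 := by
  rw [oddProj, Module.Basis.constr_basis]

theorem degProj_basis (j : ℕ) (i : Fin d → Fin 1 ⊕ Fin 1) :
    degProj k d j (𝐁 i) = if oddCount i = j then 𝐁 i else 0 := by
  rw [degProj, Module.Basis.constr_basis]

theorem parityOp_basis (i : Fin d → Fin 1 ⊕ Fin 1) :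
    parityOp k d (𝐁 i) = ((-1 : ℤ) ^ oddCount i) • 𝐁 i := by
  rw [parityOp, Module.Basis.constr_basis]

theorem flipOp_mul_self (a : Fin d) : flipOp k d a * flipOp k d a = 1 := by
  refine (𝐁).ext fun i => ?_
  rw [Module.End.mul_apply, flipOp_basis, map_zsmul, flipOp_basis, signBefore_flipAt,
    if_neg (lt_irrefl a), one_mul, flipAt_flipAt_self, smul_smul, ← Units.val_mul,
    Int.units_mul_self]
  simp

/-- Together with `flipOp_mul_self` these are the relations of a Clifford algebra with `d`
generators. -/
theorem flipOp_mul_flipOp {a b : Fin d} (hab : a ≠ b) :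
    flipOp k d a * flipOp k d b = -(flipOp k d b * flipOp k d a) := by
  refine (𝐁).ext fun i => ?_
  rw [LinearMap.neg_apply, Module.End.mul_apply, Module.End.mul_apply, flipOp_basis, flipOp_basis,
    map_zsmul, map_zsmul, flipOp_basis, flipOp_basis, signBefore_flipAt, signBefore_flipAt,
    flipAt_comm, smul_smul, smul_smul, ← neg_smul]
  congr 1
  rcases lt_or_gt_of_ne hab with h | h <;> simp [h, not_lt_of_gt h, mul_comm]

theorem oddProj_mul_self (a : Fin d) : oddProj k d a * oddProj k d a = oddProj k d a := by
  refine (𝐁).ext fun i => ?_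
  rw [Module.End.mul_apply, oddProj_basis]
  split_ifs with h <;> simp [oddProj_basis, h]

theorem oddProj_mul_oddProj (a b : Fin d) :
    oddProj k d a * oddProj k d b = oddProj k d b * oddProj k d a := by
  refine (𝐁).ext fun i => ?_
  rw [Module.End.mul_apply, Module.End.mul_apply, oddProj_basis, oddProj_basis]
  split_ifs with h1 h2 h2 <;> simp [oddProj_basis, h1, h2]

theorem oddProj_mul_flipOp {a b : Fin d} (hab : a ≠ b) :
    oddProj k d a * flipOp k d b = flipOp k d b * oddProj k d a := by
  refine (𝐁).ext fun i => ?_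
  rw [Module.End.mul_apply, Module.End.mul_apply, oddProj_basis, flipOp_basis, map_zsmul,
    oddProj_basis, flipAt_of_ne i hab]
  split_ifs with h <;> simp [flipOp_basis]

theorem oddProj_mul_flipOp_self (a : Fin d) :
    oddProj k d a * flipOp k d a = flipOp k d a * (1 - oddProj k d a) := by
  refine (𝐁).ext fun i => ?_
  rw [Module.End.mul_apply, Module.End.mul_apply, LinearMap.sub_apply, Module.End.one_apply,
    oddProj_basis, flipOp_basis, map_zsmul, oddProj_basis]
  simp only [isOddIndex_flipAt_self]
  by_cases h : IsOddIndex (i a) <;> simp [h, flipOp_basis]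

theorem flipOp_mul_oddProj_self (a : Fin d) :
    flipOp k d a * oddProj k d a = (1 - oddProj k d a) * flipOp k d a := by
  rw [sub_mul, one_mul, oddProj_mul_flipOp_self, mul_sub, mul_one, sub_sub_cancel]

/-- These are fermionic creation operators: the flips anticommute and the projections commute with
flips at other positions. For `a = b` the product is zero. -/
theorem raise_mul_raise_single (a b : Fin d) :
    flipOp k d a * (1 - oddProj k d a) * (flipOp k d b * (1 - oddProj k d b)) =
      -(flipOp k d b * (1 - oddProj k d b) * (flipOp k d a * (1 - oddProj k d a))) := by
  rcases eq_or_ne a b with rfl | hab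
  · have : flipOp k d a * (1 - oddProj k d a) * (flipOp k d a * (1 - oddProj k d a)) = 0 := by
      rw [mul_assoc, ← mul_assoc (1 - oddProj k d a), ← flipOp_mul_oddProj_self, mul_assoc,
        mul_sub, oddProj_mul_self, mul_one, sub_self, mul_zero, mul_zero]
    rw [this, neg_zero]
  · have key : ∀ {a b : Fin d}, a ≠ b →
        flipOp k d a * (1 - oddProj k d a) * (flipOp k d b * (1 - oddProj k d b)) =
        flipOp k d a * flipOp k d b * ((1 - oddProj k d a) * (1 - oddProj k d b)) := by
      intro a b hab
      rw [mul_assoc, ← mul_assoc (1 - oddProj k d a), sub_mul, one_mul, oddProj_mul_flipOp hab,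
        mul_assoc (flipOp k d a), ← mul_assoc (flipOp k d b), mul_sub (flipOp k d b), mul_one]
    have hc : (1 - oddProj k d a) * (1 - oddProj k d b) =
        (1 - oddProj k d b) * (1 - oddProj k d a) := by
      rw [mul_sub, sub_mul, sub_mul, mul_sub, sub_mul, sub_mul, oddProj_mul_oddProj a b]
      simp only [mul_one, one_mul]
      abel
    rw [key hab, key hab.symm, flipOp_mul_flipOp hab, hc, neg_mul]

theorem lower_mul_lower_single (a b : Fin d) :
    flipOp k d a * oddProj k d a * (flipOp k d b * oddProj k d b) =
      -(flipOp k d b * oddProj k d b * (flipOp k d a * oddProj k d a)) := by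
  rcases eq_or_ne a b with rfl | hab
  · have : flipOp k d a * oddProj k d a * (flipOp k d a * oddProj k d a) = 0 := by
      rw [mul_assoc, ← mul_assoc (oddProj k d a), oddProj_mul_flipOp_self, mul_assoc,
        sub_mul, oddProj_mul_self, one_mul, sub_self, mul_zero, mul_zero]
    rw [this, neg_zero]
  · have key : ∀ {a b : Fin d}, a ≠ b →
        flipOp k d a * oddProj k d a * (flipOp k d b * oddProj k d b) =
        flipOp k d a * flipOp k d b * (oddProj k d a * oddProj k d b) := by
      intro a b hab
      rw [mul_assoc, ← mul_assoc (oddProj k d a), oddProj_mul_flipOp hab,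
        mul_assoc (flipOp k d a), ← mul_assoc (flipOp k d b)]
    rw [key hab, key hab.symm, flipOp_mul_flipOp hab, oddProj_mul_oddProj a b, neg_mul]

/-- The canonical anticommutation relations: for `a = b` the two products are the complementary
projections onto odd and even factors at `a`. -/
theorem raise_mul_lower_single (a b : Fin d) :
    flipOp k d a * (1 - oddProj k d a) * (flipOp k d b * oddProj k d b) +
      flipOp k d b * oddProj k d b * (flipOp k d a * (1 - oddProj k d a)) =
      if a = b then 1 else 0 := by
  split_ifs with hab
  · subst hab
    rw [mul_assoc, ← mul_assoc (1 - oddProj k d a), ← flipOp_mul_oddProj_self, mul_assoc,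
      oddProj_mul_self, ← mul_assoc, flipOp_mul_self, one_mul, mul_assoc,
      ← mul_assoc (oddProj k d a), oddProj_mul_flipOp_self, mul_assoc, ← mul_assoc (flipOp k d a),
      flipOp_mul_self, one_mul, sub_mul, one_mul, mul_sub, mul_one, oddProj_mul_self, sub_self]
    abel
  · have e1 : flipOp k d a * (1 - oddProj k d a) * (flipOp k d b * oddProj k d b) =
        flipOp k d a * flipOp k d b * ((1 - oddProj k d a) * oddProj k d b) := by
      rw [mul_assoc, ← mul_assoc (1 - oddProj k d a), sub_mul, one_mul, oddProj_mul_flipOp hab,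
        mul_assoc (flipOp k d a), ← mul_assoc (flipOp k d b), mul_sub (flipOp k d b), mul_one]
    have e2 : flipOp k d b * oddProj k d b * (flipOp k d a * (1 - oddProj k d a)) =
        flipOp k d b * flipOp k d a * (oddProj k d b * (1 - oddProj k d a)) := by
      rw [mul_assoc, ← mul_assoc (oddProj k d b), oddProj_mul_flipOp (Ne.symm hab),
        mul_assoc (flipOp k d b), ← mul_assoc (flipOp k d a)]
    have hc : oddProj k d b * (1 - oddProj k d a) = (1 - oddProj k d a) * oddProj k d b := by
      rw [mul_sub, sub_mul, mul_one, one_mul, oddProj_mul_oddProj]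
    rw [e1, e2, hc, flipOp_mul_flipOp hab, neg_mul, neg_add_cancel]

theorem eq_zero_of_eq_neg_self (h2 : (2 : k) ≠ 0) {V : Type*} [AddCommGroup V] [Module k V] {x : V}
    (hx : x = -x) : x = 0 := by
  have : (2 : k) • x = 0 := by rw [two_smul]; nth_rw 1 [hx]; exact neg_add_cancel x
  exact (smul_eq_zero.mp this).resolve_left h2

/-- Exchanging the summation indices turns the double sum into its negative. -/
theorem raiseOp_mul_raiseOp (h2 : (2 : k) ≠ 0) : raiseOp k d * raiseOp k d = 0 := by
  refine eq_zero_of_eq_neg_self h2 ?_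
  rw [raiseOp, Finset.sum_mul_sum]
  nth_rw 1 [Finset.sum_comm]
  rw [← Finset.sum_neg_distrib]
  refine Finset.sum_congr rfl fun a _ => ?_
  rw [← Finset.sum_neg_distrib]
  exact Finset.sum_congr rfl fun b _ => raise_mul_raise_single b a

theorem lowerOp_mul_lowerOp (h2 : (2 : k) ≠ 0) : lowerOp k d * lowerOp k d = 0 := by
  refine eq_zero_of_eq_neg_self h2 ?_
  rw [lowerOp, Finset.sum_mul_sum]
  nth_rw 1 [Finset.sum_comm]
  rw [← Finset.sum_neg_distrib]
  refine Finset.sum_congr rfl fun a _ => ?_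
  rw [← Finset.sum_neg_distrib]
  exact Finset.sum_congr rfl fun b _ => lower_mul_lower_single b a

/-- Each of the `d` diagonal pairs contributes `1` and all others cancel. Through this identity the
condition `p ∣ d` enters. -/
theorem raiseOp_mul_lowerOp_add :
    raiseOp k d * lowerOp k d + lowerOp k d * raiseOp k d = (d : k) • 1 := by
  rw [raiseOp, lowerOp, Finset.sum_mul_sum, Finset.sum_mul_sum]
  nth_rw 2 [Finset.sum_comm]
  rw [← Finset.sum_add_distrib]
  have : ∀ a : Fin d, (∑ b, flipOp k d a * (1 - oddProj k d a) * (flipOp k d b * oddProj k d b) +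
      ∑ b, flipOp k d b * oddProj k d b * (flipOp k d a * (1 - oddProj k d a))) = 1 := by
    intro a
    rw [← Finset.sum_add_distrib, Finset.sum_congr rfl fun b _ => raise_mul_lower_single a b]
    simp
  rw [Finset.sum_congr rfl fun a _ => this a]
  simp [Nat.cast_smul_eq_nsmul]

theorem flipOp_mul_oddProj_basis (a : Fin d) (i : Fin d → Fin 1 ⊕ Fin 1) :
    (flipOp k d a * oddProj k d a) (𝐁 i) =
      if IsOddIndex (i a) then ((signBefore i a : ℤˣ) : ℤ) • 𝐁 (flipAt i a) else 0 := by
  rw [Module.End.mul_apply, oddProj_basis]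
  split_ifs <;> simp [flipOp_basis]

theorem flipOp_mul_one_sub_basis (a : Fin d) (i : Fin d → Fin 1 ⊕ Fin 1) :
    (flipOp k d a * (1 - oddProj k d a)) (𝐁 i) =
      if IsOddIndex (i a) then 0 else ((signBefore i a : ℤˣ) : ℤ) • 𝐁 (flipAt i a) := by
  rw [Module.End.mul_apply, LinearMap.sub_apply, Module.End.one_apply, oddProj_basis]
  split_ifs <;> simp [flipOp_basis]

theorem lowerOp_basis (i : Fin d → Fin 1 ⊕ Fin 1) : lowerOp k d (𝐁 i) =
    ∑ a, if IsOddIndex (i a) then ((signBefore i a : ℤˣ) : ℤ) • 𝐁 (flipAt i a) else 0 := by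
  rw [lowerOp, LinearMap.sum_apply]
  exact Finset.sum_congr rfl fun a _ => flipOp_mul_oddProj_basis a i

theorem raiseOp_basis (i : Fin d → Fin 1 ⊕ Fin 1) : raiseOp k d (𝐁 i) =
    ∑ a, if IsOddIndex (i a) then 0 else ((signBefore i a : ℤˣ) : ℤ) • 𝐁 (flipAt i a) := by
  rw [raiseOp, LinearMap.sum_apply]
  exact Finset.sum_congr rfl fun a _ => flipOp_mul_one_sub_basis a i

theorem degProj_mul_lowerOp (j : ℕ) :
    degProj k d j * lowerOp k d = lowerOp k d * degProj k d (j + 1) := by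
  refine (𝐁).ext fun i => ?_
  rw [Module.End.mul_apply, Module.End.mul_apply, degProj_basis, lowerOp_basis, map_sum,
    apply_ite (lowerOp k d), map_zero, lowerOp_basis, ← Finset.sum_const_zero (s := (Finset.univ : Finset (Fin d))),
    ← Finset.sum_ite_irrel]
  refine Finset.sum_congr rfl fun a _ => ?_
  by_cases h : IsOddIndex (i a)
  · rw [if_pos h, map_zsmul, degProj_basis, ← oddCount_flipAt_of_odd h]
    simp only [Nat.add_right_cancel_iff]
    split_ifs <;> simp
  · simp [h]

theorem degProj_mul_raiseOp (j : ℕ) :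
    degProj k d (j + 1) * raiseOp k d = raiseOp k d * degProj k d j := by
  refine (𝐁).ext fun i => ?_
  rw [Module.End.mul_apply, Module.End.mul_apply, degProj_basis, raiseOp_basis, map_sum,
    apply_ite (raiseOp k d), map_zero, raiseOp_basis, ← Finset.sum_const_zero (s := (Finset.univ : Finset (Fin d))),
    ← Finset.sum_ite_irrel]
  refine Finset.sum_congr rfl fun a _ => ?_
  by_cases h : IsOddIndex (i a)
  · simp [h]
  · rw [if_neg h, map_zsmul, degProj_basis, oddCount_flipAt h]
    simp only [Nat.add_right_cancel_iff]
    split_ifs <;> simp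

theorem degProj_mul_degProj (i j : ℕ) :
    degProj k d i * degProj k d j = if i = j then degProj k d j else 0 := by
  refine (𝐁).ext fun x => ?_
  rw [Module.End.mul_apply, degProj_basis]
  by_cases h : oddCount x = j <;> by_cases h' : i = j
  · simp [h, h', degProj_basis]
  · simp [h, h', degProj_basis, Ne.symm h']
  · simp [h, h', degProj_basis]
  · simp [h, h']

theorem sum_degProj : ∑ j ∈ Finset.range (d + 1), degProj k d j = 1 := by
  refine (𝐁).ext fun i => ?_
  rw [LinearMap.sum_apply, Finset.sum_congr rfl fun j _ => degProj_basis j i]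
  simp [Nat.lt_succ_of_le (oddCount_le i)]

theorem degProj_eq_zero {j : ℕ} (hj : d < j) : degProj k d j = 0 := by
  refine (𝐁).ext fun i => ?_
  rw [degProj_basis, if_neg (fun h => by have := oddCount_le i; omega), LinearMap.zero_apply]

theorem parityOp_mul_degProj (j : ℕ) :
    parityOp k d * degProj k d j = (-1 : k) ^ j • degProj k d j := by
  refine (𝐁).ext fun i => ?_
  rw [Module.End.mul_apply, LinearMap.smul_apply, degProj_basis]
  split_ifs with h
  · rw [parityOp_basis, h]
    rcases neg_one_pow_eq_or ℤ j with h1 | h1 <;> rcases Nat.even_or_odd j with h2 | h2 <;>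
      simp [h2]
  · simp

theorem degProj_mul_parityOp (j : ℕ) :
    degProj k d j * parityOp k d = parityOp k d * degProj k d j := by
  refine (𝐁).ext fun i => ?_
  rw [Module.End.mul_apply, Module.End.mul_apply, parityOp_basis, map_zsmul, degProj_basis]
  split_ifs <;> simp [parityOp_basis]

theorem parityOp_mul_lowerOp : parityOp k d * lowerOp k d = -(lowerOp k d * parityOp k d) := by
  refine (𝐁).ext fun i => ?_
  rw [LinearMap.neg_apply, Module.End.mul_apply, Module.End.mul_apply, parityOp_basis, map_zsmul,
    lowerOp_basis, map_sum, Finset.smul_sum, ← Finset.sum_neg_distrib]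
  refine Finset.sum_congr rfl fun a _ => ?_
  by_cases h : IsOddIndex (i a)
  · rw [if_pos h, map_zsmul, parityOp_basis, ← oddCount_flipAt_of_odd h, smul_smul, smul_smul,
      pow_succ, ← neg_smul]
    congr 1
    ring
  · simp [h]

theorem parityOp_mul_raiseOp : parityOp k d * raiseOp k d = -(raiseOp k d * parityOp k d) := by
  refine (𝐁).ext fun i => ?_
  rw [LinearMap.neg_apply, Module.End.mul_apply, Module.End.mul_apply, parityOp_basis, map_zsmul,
    raiseOp_basis, map_sum, Finset.smul_sum, ← Finset.sum_neg_distrib]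
  refine Finset.sum_congr rfl fun a _ => ?_
  by_cases h : IsOddIndex (i a)
  · simp [h]
  · rw [if_neg h, map_zsmul, parityOp_basis, oddCount_flipAt h, smul_smul, smul_smul,
      pow_succ, ← neg_smul]
    congr 1
    ring

/-- The operators form a ladder when `d = 0` in `k`. -/
theorem isLadder_operators (h2 : (2 : k) ≠ 0) (hd : (d : k) = 0) :
    IsLadder d (degProj k d) (lowerOp k d) (raiseOp k d * parityOp k d) where
  e_eq_zero j hj := degProj_eq_zero hj
  e_mul_e := degProj_mul_degProj
  sum_e := sum_degProj
  e_mul_a := degProj_mul_lowerOp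
  e_mul_b j := by
    rw [← mul_assoc, degProj_mul_raiseOp, mul_assoc, degProj_mul_parityOp, mul_assoc]
  a_mul_a := lowerOp_mul_lowerOp h2
  b_mul_b := by
    rw [mul_assoc, ← mul_assoc (parityOp k d), parityOp_mul_raiseOp, neg_mul, mul_neg, mul_assoc,
      ← mul_assoc, raiseOp_mul_raiseOp h2, zero_mul, neg_zero]
  comm := by
    -- Since `d = 0` in `k`, raising and lowering anticommute; the parity operator also anticommutes
    -- with lowering, and the two signs cancel.
    have h : lowerOp k d * raiseOp k d = -(raiseOp k d * lowerOp k d) := by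
      have := raiseOp_mul_lowerOp_add (k := k) (d := d)
      rw [hd, zero_smul] at this
      exact eq_neg_of_add_eq_zero_right this
    rw [← mul_assoc, h, mul_assoc (raiseOp k d) (parityOp k d), parityOp_mul_lowerOp, mul_neg,
      neg_mul, mul_assoc]

/-! ### The operators commute with the symmetric group -/

theorem mem_schurSuperalgebra_iff {T : 𝐓} : T ∈ SchurSuperalgebra k 1 1 d ↔
    ∀ σ : Equiv.Perm (Fin d), tensorAct k 1 1 d σ * T = T * tensorAct k 1 1 d σ := by
  rw [SchurSuperalgebra, Subalgebra.mem_centralizer_iff]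
  constructor
  · exact fun h σ => h _ ⟨MulOpposite.op σ, rfl⟩
  · rintro h _ ⟨σ, rfl⟩
    exact h σ.unop

/-- A permutation permutes the flip operators among themselves, so the sums over all positions
commute with it. -/
theorem tensorAct_mul_flipOp (σ : Equiv.Perm (Fin d)) (a : Fin d) :
    tensorAct k 1 1 d σ * flipOp k d (σ a) = flipOp k d a * tensorAct k 1 1 d σ := by
  refine (𝐁).ext fun i => ?_
  rw [Module.End.mul_apply, Module.End.mul_apply, tensorAct_basis, flipOp_basis, map_zsmul,
    map_zsmul, tensorAct_basis, flipOp_basis, smul_smul, smul_smul, flipAt_comp, ← Units.val_mul,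
    ← Units.val_mul, mul_comm, signBefore_comp]

theorem tensorAct_mul_oddProj (σ : Equiv.Perm (Fin d)) (a : Fin d) :
    tensorAct k 1 1 d σ * oddProj k d (σ a) = oddProj k d a * tensorAct k 1 1 d σ := by
  refine (𝐁).ext fun i => ?_
  rw [Module.End.mul_apply, Module.End.mul_apply, tensorAct_basis, map_zsmul, oddProj_basis,
    oddProj_basis, Function.comp_apply]
  split_ifs <;> simp [tensorAct_basis]

theorem lowerOp_mem : lowerOp k d ∈ SchurSuperalgebra k 1 1 d := by
  refine mem_schurSuperalgebra_iff.mpr fun σ => ?_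
  rw [lowerOp, Finset.mul_sum, Finset.sum_mul, ← Equiv.sum_comp σ]
  refine Finset.sum_congr rfl fun a _ => ?_
  rw [← mul_assoc, tensorAct_mul_flipOp, mul_assoc, tensorAct_mul_oddProj, mul_assoc]

theorem raiseOp_mem : raiseOp k d ∈ SchurSuperalgebra k 1 1 d := by
  refine mem_schurSuperalgebra_iff.mpr fun σ => ?_
  rw [raiseOp, Finset.mul_sum, Finset.sum_mul, ← Equiv.sum_comp σ]
  refine Finset.sum_congr rfl fun a _ => ?_
  rw [← mul_assoc, tensorAct_mul_flipOp, mul_assoc, mul_sub, tensorAct_mul_oddProj, mul_one,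
    mul_assoc, sub_mul, one_mul]

theorem degProj_mem (j : ℕ) : degProj k d j ∈ SchurSuperalgebra k 1 1 d := by
  refine mem_schurSuperalgebra_iff.mpr fun σ => (𝐁).ext fun i => ?_
  rw [Module.End.mul_apply, Module.End.mul_apply, tensorAct_basis, map_zsmul, degProj_basis,
    degProj_basis, oddCount_comp]
  split_ifs <;> simp [tensorAct_basis]

theorem parityOp_mem : parityOp k d ∈ SchurSuperalgebra k 1 1 d := by
  refine mem_schurSuperalgebra_iff.mpr fun σ => (𝐁).ext fun i => ?_
  rw [Module.End.mul_apply, Module.End.mul_apply, tensorAct_basis, map_zsmul, parityOp_basis,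
    parityOp_basis, oddCount_comp, map_zsmul, tensorAct_basis, smul_comm]

end Operators

/-! ### Generators of the Schur superalgebra `S(1|1,d)` -/

section Coefficients

variable {k : Type*} [Field k] {d : ℕ}

local notation "𝐓" => Module.End k (TensorSpace k 1 1 d)
local notation "𝐁" => tensorBasis k 1 1 d

/-- The matrix coefficient of `T` at the row `i` and the column `j`. -/
noncomputable def coeffAt (i j : Fin d → Fin 1 ⊕ Fin 1) : 𝐓 →ₗ[k] k :=
  (Finsupp.lapply i ∘ₗ (𝐁).repr.toLinearMap) ∘ₗ LinearMap.applyₗ (𝐁 j)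

theorem coeffAt_apply (i j : Fin d → Fin 1 ⊕ Fin 1) (T : 𝐓) :
    coeffAt i j T = (𝐁).repr (T (𝐁 j)) i := rfl

theorem repr_tensorAct (σ : Equiv.Perm (Fin d)) (i : Fin d → Fin 1 ⊕ Fin 1)
    (v : TensorSpace k 1 1 d) : (𝐁).repr (tensorAct k 1 1 d σ v) (i ∘ σ) =
      ((superSign i σ : ℤˣ) : ℤ) • (𝐁).repr v i := by
  have key : (Finsupp.lapply (i ∘ σ) ∘ₗ (𝐁).repr.toLinearMap) ∘ₗ tensorAct k 1 1 d σ =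
      ((superSign i σ : ℤˣ) : ℤ) • (Finsupp.lapply i ∘ₗ (𝐁).repr.toLinearMap) := by
    refine (𝐁).ext fun j => ?_
    simp only [LinearMap.comp_apply, LinearMap.smul_apply, LinearEquiv.coe_coe, tensorAct_basis,
      map_zsmul, Module.Basis.repr_self, Finsupp.lapply_apply]
    by_cases h : j = i
    · subst h; simp
    · have h' : j ∘ σ ≠ i ∘ σ := fun h0 => h (σ.surjective.injective_comp_right h0)
      rw [Finsupp.single_eq_of_ne h'.symm, Finsupp.single_eq_of_ne (Ne.symm h), smul_zero,
        smul_zero]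
  exact LinearMap.congr_fun key v

/-- Up to sign, the coefficients in the column `j` are constant on the orbits of the stabilizer of
`j`; one free parameter per orbit is left at most. -/
theorem coeffAt_comp {T : 𝐓} (hT : T ∈ SchurSuperalgebra k 1 1 d) (σ : Equiv.Perm (Fin d))
    {i j : Fin d → Fin 1 ⊕ Fin 1} (hj : j ∘ σ = j) :
    coeffAt (i ∘ σ) j T = ((superSign j σ * superSign i σ : ℤˣ) : ℤ) • coeffAt i j T := by
  have h := LinearMap.congr_fun (mem_schurSuperalgebra_iff.mp hT σ) (𝐁 j)
  rw [Module.End.mul_apply, Module.End.mul_apply, tensorAct_basis, map_zsmul, hj] at h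
  have h1 := repr_tensorAct σ i (T (𝐁 j))
  rw [h, map_zsmul, Finsupp.smul_apply] at h1
  rw [coeffAt_apply, coeffAt_apply, Units.val_mul, mul_smul, ← h1, smul_smul, ← Units.val_mul,
    Int.units_mul_self, Units.val_one, one_smul]

theorem units_smul_ne_zero (s : ℤˣ) {x : k} (hx : x ≠ 0) : (s : ℤ) • x ≠ 0 := by
  rcases Int.units_eq_one_or s with rfl | rfl <;> simpa using hx

/-- Coefficients vanish at positions `i` and `j` that differ in two factors of the same parity. -/
theorem coeffAt_eq_zero (h2 : (2 : k) ≠ 0) {T : 𝐓} (hT : T ∈ SchurSuperalgebra k 1 1 d)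
    {i j : Fin d → Fin 1 ⊕ Fin 1} {a b : Fin d} (hab : a ≠ b) (hj : j a = j b) (hi : i a = i b)
    (hij : i a ≠ j a) : coeffAt i j T = 0 := by
  have h := coeffAt_comp hT (Equiv.swap a b) (i := i) (comp_swap_eq hj)
  rw [comp_swap_eq hi] at h
  refine eq_zero_of_eq_neg_self h2 ?_
  -- The transposition fixes both `i` and `j`, but exchanges two odd vectors in exactly one of them;
  -- so the coefficient is its own negative.
  have hs : superSign j (Equiv.swap a b) * superSign i (Equiv.swap a b) = -1 := by
    by_cases ha : IsOddIndex (j a)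
    · have hia : ¬ IsOddIndex (i a) := fun h' => hij (index_ext (iff_of_true h' ha))
      rw [superSign_swap_of_odd hab ha (hj ▸ ha), superSign_swap_of_even hia (hi ▸ hia)]
      rfl
    · have hia : IsOddIndex (i a) := by
        by_contra h'
        exact hij (index_ext (iff_of_false h' ha))
      rw [superSign_swap_of_even ha (hj ▸ ha), superSign_swap_of_odd hab hia (hi ▸ hia)]
      rfl
  rw [hs] at h
  simpa using h

/-- An element of the Schur superalgebra kills a basis vector if the coefficients at all positions
of the four possible types vanish. -/
theorem apply_eq_zero_of_coeffAt (h2 : (2 : k) ≠ 0) {T : 𝐓} (hT : T ∈ SchurSuperalgebra k 1 1 d)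
    {j : Fin d → Fin 1 ⊕ Fin 1} (h0 : coeffAt j j T = 0) (h1 : ∀ a, coeffAt (flipAt j a) j T = 0)
    (h3 : ∀ a b, IsOddIndex (j a) → ¬ IsOddIndex (j b) →
      coeffAt (flipAt (flipAt j b) a) j T = 0) : T (𝐁 j) = 0 := by
  rw [← (𝐁).repr.map_eq_zero_iff]
  ext i
  rw [Finsupp.zero_apply, ← coeffAt_apply]
  by_contra hne
  have hv : ∀ a b, a ≠ b → j a = j b → i a = i b → i a = j a := fun a b hab hj hi => by
    by_contra hij
    exact hne (coeffAt_eq_zero h2 hT hab hj hi hij)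
  by_cases hij : i = j
  · exact hne (hij ▸ h0)
  obtain ⟨a, ha⟩ := Function.ne_iff.mp hij
  have hfa : i a = flipAt j a a := eq_flipAt_self_of_ne ha
  by_cases hone : ∀ b, b ≠ a → i b = j b
  · refine hne ?_
    have : i = flipAt j a := by
      funext b
      by_cases hb : b = a
      · rw [hb, hfa]
      · rw [hone b hb, flipAt_of_ne j hb]
    rw [this, h1]
  push Not at hone
  obtain ⟨b, hba, hb⟩ := hone
  -- Two positions where `i` and `j` differ must have different parities in `j`. As there are only
  -- two parities, there are at most two such positions.
  have hdiff : ∀ {a b}, a ≠ b → i a ≠ j a → i b ≠ j b → j a ≠ j b := by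
    intro a b hab ha hb hj
    refine ha (hv a b hab hj ?_)
    refine index_ext ?_
    rw [eq_flipAt_self_of_ne ha, eq_flipAt_self_of_ne hb, isOddIndex_flipAt_self,
      isOddIndex_flipAt_self, hj]
  have hI : i = flipAt (flipAt j a) b := by
    funext c
    by_cases hca : c = a
    · rw [hca, flipAt_of_ne _ hba.symm, hfa]
    by_cases hcb : c = b
    · rw [hcb, flipAt_comm, flipAt_of_ne _ hba, eq_flipAt_self_of_ne hb]
    rw [flipAt_of_ne _ hcb, flipAt_of_ne _ hca]
    by_contra hc
    have e1 := hdiff hca hc ha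
    have e2 := hdiff hcb hc hb
    have e3 := hdiff hba hb ha
    revert e1 e2 e3
    generalize j a = x, j b = y, j c = z
    revert x y z
    decide
  have hpar := hdiff hba hb ha
  by_cases hodd : IsOddIndex (j a)
  · refine hne ?_
    rw [hI, flipAt_comm]
    exact h3 a b hodd fun h' => hpar (index_ext (iff_of_true h' hodd))
  · refine hne ?_
    rw [hI]
    refine h3 b a ?_ hodd
    by_contra h'
    exact hpar (index_ext (iff_of_false h' hodd))

/-- On positions that are conjugate under the stabilizer of `j`, the coefficients of one element of
the Schur superalgebra are a multiple of the nonzero coefficients of another one. -/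
theorem exists_coeffAt_eq_mul {T X : 𝐓} (hT : T ∈ SchurSuperalgebra k 1 1 d)
    (hX : X ∈ SchurSuperalgebra k 1 1 d) {j : Fin d → Fin 1 ⊕ Fin 1}
    {P : (Fin d → Fin 1 ⊕ Fin 1) → Prop}
    (hP : ∀ i i', P i → P i' → ∃ σ : Equiv.Perm (Fin d), j ∘ σ = j ∧ i ∘ σ = i')
    (hne : ∀ i, P i → coeffAt i j X ≠ 0) :
    ∃ c : k, ∀ i, P i → coeffAt i j T = c * coeffAt i j X := by
  by_cases hex : ∃ i, P i
  · obtain ⟨i, hi⟩ := hex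
    refine ⟨coeffAt i j T / coeffAt i j X, fun i' hi' => ?_⟩
    obtain ⟨σ, hσ, rfl⟩ := hP i i' hi hi'
    rw [coeffAt_comp hT σ hσ, coeffAt_comp hX σ hσ, mul_smul_comm, div_mul_cancel₀ _ (hne i hi)]
  · exact ⟨0, fun i hi => absurd ⟨i, hi⟩ hex⟩

theorem flipAt_comp_swap {j : Fin d → Fin 1 ⊕ Fin 1} {a b : Fin d} (h : j a = j b) :
    flipAt j a ∘ Equiv.swap a b = flipAt j b := by
  have := flipAt_comp j (Equiv.swap a b) b
  rwa [Equiv.swap_apply_right, comp_swap_eq h] at this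

theorem coeffAt_lowerOp (i j : Fin d → Fin 1 ⊕ Fin 1) : coeffAt i j (lowerOp k d) =
    ∑ a, if IsOddIndex (j a) ∧ flipAt j a = i then ((signBefore j a : ℤˣ) : k) else 0 := by
  rw [coeffAt_apply, lowerOp_basis, map_sum, Finsupp.finsetSum_apply]
  refine Finset.sum_congr rfl fun a _ => ?_
  by_cases h : IsOddIndex (j a)
  · rw [if_pos h, map_zsmul, Module.Basis.repr_self, Finsupp.smul_apply, Finsupp.single_apply]
    by_cases h' : flipAt j a = i <;> simp [h, h']
  · simp [h]

theorem coeffAt_raiseOp (i j : Fin d → Fin 1 ⊕ Fin 1) : coeffAt i j (raiseOp k d) =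
    ∑ a, if ¬ IsOddIndex (j a) ∧ flipAt j a = i then ((signBefore j a : ℤˣ) : k) else 0 := by
  rw [coeffAt_apply, raiseOp_basis, map_sum, Finsupp.finsetSum_apply]
  refine Finset.sum_congr rfl fun a _ => ?_
  by_cases h : IsOddIndex (j a)
  · simp [h]
  · rw [if_neg h, map_zsmul, Module.Basis.repr_self, Finsupp.smul_apply, Finsupp.single_apply]
    by_cases h' : flipAt j a = i <;> simp [h, h']

theorem coeffAt_lowerOp_mul_raiseOp (i j : Fin d → Fin 1 ⊕ Fin 1) :
    coeffAt i j (lowerOp k d * raiseOp k d) =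
      ∑ b, if IsOddIndex (j b) then 0 else
        ((signBefore j b : ℤˣ) : ℤ) • coeffAt i (flipAt j b) (lowerOp k d) := by
  rw [coeffAt_apply, Module.End.mul_apply, raiseOp_basis, map_sum, map_sum, Finsupp.finsetSum_apply]
  refine Finset.sum_congr rfl fun b _ => ?_
  split_ifs with h
  · simp
  · rw [map_zsmul, map_zsmul, Finsupp.smul_apply, coeffAt_apply]

theorem oddCount_of_coeffAt_lowerOp {i j : Fin d → Fin 1 ⊕ Fin 1}
    (h : coeffAt i j (lowerOp k d) ≠ 0) : oddCount i + 1 = oddCount j := by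
  rw [coeffAt_lowerOp] at h
  obtain ⟨a, -, ha⟩ := Finset.exists_ne_zero_of_sum_ne_zero h
  split_ifs at ha with h1
  · rw [← h1.2, oddCount_flipAt_of_odd h1.1]
  · exact absurd rfl ha

theorem oddCount_of_coeffAt_raiseOp {i j : Fin d → Fin 1 ⊕ Fin 1}
    (h : coeffAt i j (raiseOp k d) ≠ 0) : oddCount i = oddCount j + 1 := by
  rw [coeffAt_raiseOp] at h
  obtain ⟨a, -, ha⟩ := Finset.exists_ne_zero_of_sum_ne_zero h
  split_ifs at ha with h1
  · rw [← h1.2, oddCount_flipAt h1.1]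
  · exact absurd rfl ha

theorem oddCount_of_coeffAt_lowerOp_mul_raiseOp {i j : Fin d → Fin 1 ⊕ Fin 1}
    (h : coeffAt i j (lowerOp k d * raiseOp k d) ≠ 0) : oddCount i = oddCount j := by
  rw [coeffAt_lowerOp_mul_raiseOp] at h
  obtain ⟨b, -, hb⟩ := Finset.exists_ne_zero_of_sum_ne_zero h
  split_ifs at hb with h1
  · exact absurd rfl hb
  · have := oddCount_of_coeffAt_lowerOp (right_ne_zero_of_smul hb)
    rw [oddCount_flipAt h1] at this
    omega

theorem signBefore_ne_zero (j : Fin d → Fin 1 ⊕ Fin 1) (a : Fin d) :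
    ((signBefore j a : ℤˣ) : k) ≠ 0 := by
  rcases Int.units_eq_one_or (signBefore j a) with h | h <;> simp [h]

theorem coeffAt_lowerOp_flipAt {j : Fin d → Fin 1 ⊕ Fin 1} {a : Fin d} (ha : IsOddIndex (j a)) :
    coeffAt (flipAt j a) j (lowerOp k d) ≠ 0 := by
  rw [coeffAt_lowerOp, Finset.sum_eq_single a]
  · rw [if_pos ⟨ha, rfl⟩]; exact signBefore_ne_zero j a
  · intro b _ hb; exact if_neg fun h => hb (flipAt_injective j h.2)
  · simp

theorem coeffAt_raiseOp_flipAt {j : Fin d → Fin 1 ⊕ Fin 1} {a : Fin d} (ha : ¬ IsOddIndex (j a)) :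
    coeffAt (flipAt j a) j (raiseOp k d) ≠ 0 := by
  rw [coeffAt_raiseOp, Finset.sum_eq_single a]
  · rw [if_pos ⟨ha, rfl⟩]; exact signBefore_ne_zero j a
  · intro b _ hb; exact if_neg fun h => hb (flipAt_injective j h.2)
  · simp

theorem ne_of_isOddIndex {j : Fin d → Fin 1 ⊕ Fin 1} {a b : Fin d} (ha : IsOddIndex (j a))
    (hb : ¬ IsOddIndex (j b)) : a ≠ b := by
  rintro rfl
  exact hb ha

/-- Exactly one way leads from `j` to this position: create at `b`, then annihilate at `a`. So
nothing can cancel. -/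
theorem coeffAt_lowerOp_mul_raiseOp_flipAt {j : Fin d → Fin 1 ⊕ Fin 1} {a b : Fin d}
    (ha : IsOddIndex (j a)) (hb : ¬ IsOddIndex (j b)) :
    coeffAt (flipAt (flipAt j b) a) j (lowerOp k d * raiseOp k d) ≠ 0 := by
  have hab : a ≠ b := ne_of_isOddIndex ha hb
  rw [coeffAt_lowerOp_mul_raiseOp, Finset.sum_eq_single b]
  · rw [if_neg hb]
    refine units_smul_ne_zero _ (coeffAt_lowerOp_flipAt ?_)
    rwa [flipAt_of_ne j hab]
  · intro c _ hc
    split_ifs with h1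
    · rfl
    · rw [coeffAt_lowerOp, Finset.sum_eq_zero, smul_zero]
      intro x _
      refine if_neg fun ⟨h2, h3⟩ => ?_
      have h4 := congrFun h3 c
      have hca : c ≠ a := (ne_of_isOddIndex ha h1).symm
      rw [flipAt_of_ne _ hca, flipAt_of_ne _ hc] at h4
      by_cases hcx : c = x
      · subst hcx
        rw [flipAt_flipAt_self] at h3
        have h5 := congrFun h3 b
        rw [flipAt_of_ne _ hab.symm] at h5
        exact flipAt_self_ne j b h5.symm
      · rw [flipAt_of_ne _ hcx] at h4
        exact flipAt_self_ne j c h4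
  · simp

/-- Every element of the Schur superalgebra is, on tensors with a fixed number of odd factors, a
combination of four operators. -/
theorem exists_mul_degProj_eq (h2 : (2 : k) ≠ 0) {T : 𝐓} (hT : T ∈ SchurSuperalgebra k 1 1 d)
    (n : ℕ) : ∃ c₁ c₂ c₃ c₄ : k, T * degProj k d n = (c₁ • 1 + c₂ • lowerOp k d +
      c₃ • raiseOp k d + c₄ • (lowerOp k d * raiseOp k d)) * degProj k d n := by
  rcases lt_or_ge d n with hn | hn
  · exact ⟨0, 0, 0, 0, by simp [degProj_eq_zero hn]⟩
  -- The basis vectors with `n` odd factors form one orbit up to sign, so it suffices to compare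
  -- both sides on one of them.
  obtain ⟨j, hj⟩ := exists_oddCount_eq hn
  have hL := lowerOp_mem (k := k) (d := d)
  have hR := raiseOp_mem (k := k) (d := d)
  have hLR := mul_mem hL hR
  obtain ⟨c₂, h₂⟩ := exists_coeffAt_eq_mul hT hL (j := j)
    (P := fun i => ∃ a, IsOddIndex (j a) ∧ i = flipAt j a) (by
      rintro _ _ ⟨a, ha, rfl⟩ ⟨b, hb, rfl⟩
      have hab : j a = j b := index_ext (iff_of_true ha hb)
      exact ⟨Equiv.swap a b, comp_swap_eq hab, flipAt_comp_swap hab⟩)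
    (by rintro _ ⟨a, ha, rfl⟩; exact coeffAt_lowerOp_flipAt ha)
  obtain ⟨c₃, h₃⟩ := exists_coeffAt_eq_mul hT hR (j := j)
    (P := fun i => ∃ a, ¬ IsOddIndex (j a) ∧ i = flipAt j a) (by
      rintro _ _ ⟨a, ha, rfl⟩ ⟨b, hb, rfl⟩
      have hab : j a = j b := index_ext (iff_of_false ha hb)
      exact ⟨Equiv.swap a b, comp_swap_eq hab, flipAt_comp_swap hab⟩)
    (by rintro _ ⟨a, ha, rfl⟩; exact coeffAt_raiseOp_flipAt ha)
  obtain ⟨c₄, h₄⟩ := exists_coeffAt_eq_mul hT hLR (j := j)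
    (P := fun i => ∃ a b, IsOddIndex (j a) ∧ ¬ IsOddIndex (j b) ∧ i = flipAt (flipAt j b) a) (by
      rintro _ _ ⟨a, b, ha, hb, rfl⟩ ⟨a', b', ha', hb', rfl⟩
      have haa : j a = j a' := index_ext (iff_of_true ha ha')
      have hbb : j b = j b' := index_ext (iff_of_false hb hb')
      refine ⟨Equiv.swap b b' * Equiv.swap a a', ?_, ?_⟩
      · rw [Equiv.Perm.coe_mul, ← Function.comp_assoc, comp_swap_eq hbb, comp_swap_eq haa]
      · have hswap : Equiv.swap b b' a = a := Equiv.swap_apply_of_ne_of_ne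
          (ne_of_isOddIndex ha hb) (ne_of_isOddIndex ha hb')
        have e1 : flipAt (flipAt j b) a ∘ Equiv.swap b b' = flipAt (flipAt j b') a := by
          have := flipAt_comp (flipAt j b) (Equiv.swap b b') a
          rwa [hswap, flipAt_comp_swap hbb] at this
        have hne := ne_of_isOddIndex ha hb'
        have hne' := ne_of_isOddIndex ha' hb'
        rw [Equiv.Perm.coe_mul, ← Function.comp_assoc, e1, flipAt_comp_swap]
        rw [flipAt_of_ne _ hne, flipAt_of_ne _ hne', haa])
    (by rintro _ ⟨a, b, ha, hb, rfl⟩; exact coeffAt_lowerOp_mul_raiseOp_flipAt ha hb)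
  have cone : ∀ i : Fin d → Fin 1 ⊕ Fin 1, coeffAt i j (1 : 𝐓) = if j = i then 1 else 0 := by
    intro i
    rw [coeffAt_apply, Module.End.one_apply, Module.Basis.repr_self, Finsupp.single_apply]
  -- The product `lowerOp * raiseOp` also has a diagonal coefficient, which has to be subtracted.
  let c₁ : k := coeffAt j j T - c₄ * coeffAt j j (lowerOp k d * raiseOp k d)
  refine ⟨c₁, c₂, c₃, c₄, ?_⟩
  let Y : 𝐓 := c₁ • 1 + c₂ • lowerOp k d + c₃ • raiseOp k d + c₄ • (lowerOp k d * raiseOp k d)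
  have hY : Y ∈ SchurSuperalgebra k 1 1 d := by
    refine add_mem (add_mem (add_mem ?_ ?_) ?_) ?_ <;> apply Subalgebra.smul_mem
    exacts [one_mem _, hL, hR, hLR]
  have cY : ∀ i, coeffAt i j (T - Y) = coeffAt i j T - (c₁ * coeffAt i j (1 : 𝐓) +
      c₂ * coeffAt i j (lowerOp k d) + c₃ * coeffAt i j (raiseOp k d) +
      c₄ * coeffAt i j (lowerOp k d * raiseOp k d)) := by
    intro i
    simp only [Y, map_sub, map_add, map_smul, smul_eq_mul]
  have zL : ∀ i, oddCount i + 1 ≠ oddCount j → coeffAt i j (lowerOp k d) = 0 := fun i hi => by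
    by_contra h; exact hi (oddCount_of_coeffAt_lowerOp h)
  have zR : ∀ i, oddCount i ≠ oddCount j + 1 → coeffAt i j (raiseOp k d) = 0 := fun i hi => by
    by_contra h; exact hi (oddCount_of_coeffAt_raiseOp h)
  have zLR : ∀ i, oddCount i ≠ oddCount j → coeffAt i j (lowerOp k d * raiseOp k d) = 0 :=
    fun i hi => by by_contra h; exact hi (oddCount_of_coeffAt_lowerOp_mul_raiseOp h)
  have zone : ∀ i, i ≠ j → coeffAt i j (1 : 𝐓) = 0 := fun i hi => by rw [cone, if_neg hi.symm]
  have hzero : (T - Y) (𝐁 j) = 0 := by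
    refine apply_eq_zero_of_coeffAt h2 (sub_mem hT hY) ?_ ?_ ?_
    · rw [cY, cone, if_pos rfl, zL _ (by omega), zR _ (by omega)]
      simp only [c₁]
      ring
    · intro a
      have hne : flipAt j a ≠ j := fun h => flipAt_self_ne j a (congrFun h a)
      by_cases ha : IsOddIndex (j a)
      · have hc := oddCount_flipAt_of_odd ha
        rw [cY, zone _ hne, zR _ (by omega), zLR _ (by omega), h₂ _ ⟨a, ha, rfl⟩]
        ring
      · have hc := oddCount_flipAt ha
        rw [cY, zone _ hne, zL _ (by omega), zLR _ (by omega), h₃ _ ⟨a, ha, rfl⟩]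
        ring
    · intro a b ha hb
      have hab := ne_of_isOddIndex ha hb
      have hne : flipAt (flipAt j b) a ≠ j := fun h => by
        have := congrFun h b
        rw [flipAt_of_ne _ hab.symm] at this
        exact flipAt_self_ne j b this
      have hc1 := oddCount_flipAt hb
      have hc2 := oddCount_flipAt_of_odd (i := flipAt j b) (a := a)
        (by rwa [flipAt_of_ne j hab])
      rw [cY, zone _ hne, zL _ (by omega), zR _ (by omega), h₄ _ ⟨a, b, ha, hb, rfl⟩]
      ring
  rw [← sub_eq_zero, ← sub_mul]
  refine (𝐁).ext fun i => ?_
  rw [Module.End.mul_apply, degProj_basis, LinearMap.zero_apply]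
  split_ifs with hi
  -- Vanishing at `j` is carried to every other index of the same degree by a permutation, which
  -- commutes with `T - Y`.
  · obtain ⟨σ, rfl⟩ := exists_comp_eq (hi.trans hj.symm)
    have h3 := LinearMap.congr_fun (mem_schurSuperalgebra_iff.mp (sub_mem hT hY) σ) (𝐁 j)
    rw [Module.End.mul_apply, Module.End.mul_apply, hzero, map_zero, tensorAct_basis,
      map_zsmul] at h3
    have h4 := congrArg (((superSign j σ : ℤˣ) : ℤ) • ·) h3
    simp only [smul_zero, smul_smul, ← Units.val_mul, Int.units_mul_self, Units.val_one,
      one_smul] at h4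
    exact h4.symm
  · exact map_zero _

end Coefficients

/-! ### The ladder of `S(1|1,d)` and the theorem -/

section Main

variable {k : Type*} [Field k] {d : ℕ}

/-- The ladder of the Schur superalgebra `S(1|1,d)`. -/
theorem exists_isLadder_schurSuperalgebra (h2 : (2 : k) ≠ 0) (hd : (d : k) = 0) :
    ∃ (e : ℕ → SchurSuperalgebra k 1 1 d) (a b : SchurSuperalgebra k 1 1 d), IsLadder d e a b ∧
      Algebra.adjoin k (Set.range e ∪ {a, b}) = ⊤ ∧
      ∀ j, 0 < j → j < d → a * b * e j ≠ 0 := by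
  let e : ℕ → SchurSuperalgebra k 1 1 d := fun j => ⟨degProj k d j, degProj_mem j⟩
  let a : SchurSuperalgebra k 1 1 d := ⟨lowerOp k d, lowerOp_mem⟩
  let b : SchurSuperalgebra k 1 1 d :=
    ⟨raiseOp k d * parityOp k d, mul_mem raiseOp_mem parityOp_mem⟩
  have h := isLadder_operators h2 hd
  have hlad : IsLadder d e a b :=
    { e_eq_zero := fun j hj => Subtype.ext (h.e_eq_zero j hj)
      e_mul_e := fun i j => Subtype.ext ((h.e_mul_e i j).trans (by split_ifs <;> rfl))
      sum_e := Subtype.ext (by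
        rw [AddSubmonoidClass.coe_finsetSum]
        exact h.sum_e)
      e_mul_a := fun j => Subtype.ext (h.e_mul_a j)
      e_mul_b := fun j => Subtype.ext (h.e_mul_b j)
      a_mul_a := Subtype.ext h.a_mul_a
      b_mul_b := Subtype.ext h.b_mul_b
      comm := Subtype.ext h.comm }
  -- On degree `j` the parity operator is the scalar `(-1) ^ j`, so the untwisted raising operator
  -- is recovered from `b`.
  have hRe : ∀ j, raiseOp k d * degProj k d j =
      (-1 : k) ^ j • (raiseOp k d * parityOp k d * degProj k d j) := by
    intro j
    rw [mul_assoc, parityOp_mul_degProj, mul_smul_comm, smul_smul, ← mul_pow]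
    simp
  refine ⟨e, a, b, hlad, ?_, ?_⟩
  · set S := Algebra.adjoin k (Set.range e ∪ {a, b})
    have he : ∀ j, e j ∈ S := fun j => Algebra.subset_adjoin (Or.inl ⟨j, rfl⟩)
    have ha : a ∈ S := Algebra.subset_adjoin (Or.inr (Or.inl rfl))
    have hb : b ∈ S := Algebra.subset_adjoin (Or.inr (Or.inr rfl))
    rw [eq_top_iff]
    rintro T -
    rw [← mul_one T, ← hlad.sum_e, Finset.mul_sum]
    refine sum_mem fun j _ => ?_
    obtain ⟨c₁, c₂, c₃, c₄, hc⟩ := exists_mul_degProj_eq h2 T.2 j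
    have : T * e j = c₁ • e j + c₂ • (a * e j) + (c₃ * (-1) ^ j) • (b * e j) +
        (c₄ * (-1) ^ j) • (a * (b * e j)) := by
      refine Subtype.ext (hc.trans ?_)
      simp only [add_mul, smul_mul_assoc, one_mul, mul_assoc (lowerOp k d) (raiseOp k d), hRe,
        mul_smul_comm, smul_smul]
      rfl
    rw [this]
    exact add_mem (add_mem (add_mem (S.smul_mem (he j) _) (S.smul_mem (mul_mem ha (he j)) _))
      (S.smul_mem (mul_mem hb (he j)) _)) (S.smul_mem (mul_mem ha (mul_mem hb (he j))) _)
  · intro n hn0 hnd h0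
    have h0' : lowerOp k d * (raiseOp k d * parityOp k d) * degProj k d n = 0 :=
      congrArg Subtype.val h0
    have h1 : lowerOp k d * raiseOp k d * degProj k d n = 0 := by
      rw [mul_assoc, hRe, mul_smul_comm, ← mul_assoc, h0', smul_zero]
    obtain ⟨j, hj⟩ := exists_oddCount_eq hnd.le
    -- In an interior degree there are both an odd and an even factor, and exchanging their parities
    -- has a nonzero coefficient.
    obtain ⟨x, hx⟩ : ∃ x, IsOddIndex (j x) := by
      have hpos : 0 < oddCount j := by omega
      obtain ⟨x, hx⟩ := Finset.card_pos.mp hpos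
      exact ⟨x, (Finset.mem_filter.mp hx).2⟩
    obtain ⟨y, hy⟩ : ∃ y, ¬ IsOddIndex (j y) := by
      by_contra! hall
      have : oddCount j = d := by simp [oddCount, hall]
      omega
    refine coeffAt_lowerOp_mul_raiseOp_flipAt (k := k) hx hy ?_
    have h3 := LinearMap.congr_fun h1 (tensorBasis k 1 1 d j)
    rw [Module.End.mul_apply, degProj_basis, if_pos hj] at h3
    rw [coeffAt_apply, h3]
    simp

end Main

theorem theorem4p1p2 {k : Type*} [Field k] [IsAlgClosed k] (p : ℕ) [CharP k p] (hp : p ≠ 2)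
    (d : ℕ) (hd : 1 ≤ d) (hpd : p ∣ d) :
    Nonempty (SchurSuperalgebra k 1 1 d ≃ₐ[k] ATilde k d) ∧
      HasFiniteRepresentationType k (SchurSuperalgebra k 1 1 d) := by
  have hp0 : p ≠ 0 := by
    rintro rfl
    rw [zero_dvd_iff] at hpd
    omega
  have hprime : p.Prime := (CharP.char_is_prime_or_zero k p).resolve_right hp0
  have h2 : (2 : k) ≠ 0 := by
    intro h
    have h' : ((2 : ℕ) : k) = 0 := by exact_mod_cast h
    rw [CharP.cast_eq_zero_iff k p] at h'
    exact hp ((Nat.prime_dvd_prime_iff_eq hprime Nat.prime_two).mp h')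
  have hd0 : (d : k) = 0 := (CharP.cast_eq_zero_iff k p d).mpr hpd
  -- A positive multiple of a prime is at least `2`, so an interior vertex exists.
  have hd2 : 2 ≤ d := hprime.two_le.trans (Nat.le_of_dvd (by omega) hpd)
  obtain ⟨e, a, b, h, hgen, hne⟩ := exists_isLadder_schurSuperalgebra h2 hd0
  exact ⟨h.nonempty_algEquiv_ATilde k hd2 hgen hne, h.hasFiniteRepresentationType hgen⟩
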